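/- Let $\Gamma=\mathrm{Sp}_4(\mathbb Z)$ act on the Siegel upper half space $\mathbb H_2=\{Z=X+iY\in M_2(\mathbb C): Z={}^tZ,\ Y>0\}$ by $\gamma\langle Z\rangle=(AZ+B)(CZ+D)^{-1}$ for $\gamma=\begin{pmatrix}A&B\\C&D\end{pmatrix}$, and let $\Gamma_\infty=\left\{\begin{pmatrix}I_2&X\\0&I_2\end{pmatrix}: X\in M_2(\mathbb Z),\ {}^tX=X\right\}$. For $\mathcal X = \mathbb H, \mathbb R, \mathbb R^+,\mathcal M_2,\Gamma\backslash\mathbb H_2$ let $C_c^\infty(\mathcal X)$ denote the smooth compactly supported functions $\mathcal X\to\mathbb C$ (for the orbifold $\Gamma\backslash\mathbb H_2$: compactly supported functions whose pull-back to $\mathbb H_2$ is smooth), where $\mathcal M_2=\mathrm{GL}_2(\mathbb R)^+/\mathrm{SO}(2)$. Let $\iota$ be the bijection $A\mapsto A\,{}^t\!A$ from $\mathcal M_2$ onto the positive definite symmetric real $2\times2$ matrices. Let $\Lambda_2=\left\{\begin{pmatrix}m&r/2\\r/2&n\end{pmatrix}:m,r,n\in\mathbb Z\right\}$ and $e(x)=e^{2\pi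 i x}$. For $h\in C_c^\infty(\mathcal M_2)$ and $S\in\Lambda_2$ define the incomplete Siegel--Poincar\'e series $$P_S^h(Z)=\sum_{\gamma\in\Gamma_\infty\backslash\Gamma}h_S(\gamma\langle Z\rangle),\qquad h_S(X+iY)=e(\mathrm{Tr}(SX))\,h(\iota^{-1}(Y)).$$ (i) For all $h\in C_c^\infty(\mathcal M_2)$ and $S\in\Lambda_2$, the sum has only finitely many nonzero terms for each $Z$, and it defines an element $P_S^h\in C_c^\infty(\Gamma\backslash\mathbb H_2)$. (ii) The finite linear combinations of the $P_S^h$ are uniformly dense in $C_c^\infty(\Gamma\backslash\mathbb H_2)$: for every $\phi\in C_c^\infty(\Gamma\backslash\mathbb H_2)$ and $\varepsilon>0$ there are finitely many $a_i\in\mathbb R$, $h_i\in C_c^\infty(\mathcal M_2)$, $S_i\in\Lambda_2$ with $\left|\phi(Z)-\sum_i a_iP_{S_i}^{h_i}(Z)\right|<\varepsilon$ for all $Z\in\Gamma\backslash\mathbb H_2$. For $0\ne F\in S_k(\Gamma)$ (Siegel cusp forms of weight $k$) and bounded continuous $\phi:\Gamma\backslash\mathbb H_2\to\mathbb C$, put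 $d\mu=(\det Y)^{-3}dX\,dY$, $\mu_F(\phi)=\int_{\Gamma\backslash\mathbb H_2}|F(Z)|^2\phi(Z)(\det Y)^k\,d\mu$ and $$D_F(\phi)=\frac{\mu_F(\phi)}{\mu_F(1)}-\frac1{\mathrm{vol}(\Gamma\backslash\mathbb H_2)}\int_{\Gamma\backslash\mathbb H_2}\phi\,d\mu .$$ Let $(F_i)$ be a sequence of nonzero Siegel cusp forms for $\Gamma$, of weights $k_i$. (iii) If $D_{F_i}(P_S^h)\to0$ as $i\to\infty$ for every $h\in C_c^\infty(\mathcal M_2)$ and $S\in\Lambda_2$, then $D_{F_i}(\phi)\to0$ for every bounded continuous $\phi$ on $\Gamma\backslash\mathbb H_2$. (iv) Let $R_1$ be the set of functions on $\mathcal M_2$ of the form $A\mapsto\psi_1(A\cdot i)\,\psi_2(\det A)$ with $\psi_1\in C_c^\infty(\mathbb H)$, $\psi_2\in C_c^\infty(\mathbb R^+)$, and $R_2$ the set of functions $h$ on $\mathcal M_2$ of the form $h\left(\begin{pmatrix}1&u\\0&1\end{pmatrix}\begin{pmatrix}\sqrt{t_1}&0\\0&\sqrt{t_2}\end{pmatrix}\right)=\phi_1(t_1)\phi_2(t_2)\phi_3(u)$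 with $\phi_1,\phi_2\in C_c^\infty(\mathbb R^+)$, $\phi_3\in C_c^\infty(\mathbb R)$. For each $S\in\Lambda_2$ choose $r(S)\in\{1,2\}$. If $D_{F_i}(P_S^h)\to0$ for every $S\in\Lambda_2$ and every $h\in R_{r(S)}$, then $D_{F_i}(\phi)\to0$ for every bounded continuous $\phi$ on $\Gamma\backslash\mathbb H_2$. -/

import Mathlib

open Matrix Filter Topology MeasureTheory UpperHalfPlane
open scoped MatrixGroups ContDiff BoundedContinuousFunction

namespace SiegelPoincare

/-! ### Smooth functions on spaces that sit as open subsets in a vector space -/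

/-- If `c` identifies `X` with an open subset `Set.range c` of the real normed space `E`, then
`SmoothIn c f` says that `f : X → ℂ` is a smooth (`C^∞`) function in the coordinates `c`. -/
def SmoothIn {X E : Type*} [NormedAddCommGroup E] [NormedSpace ℝ E] (c : X → E) (f : X → ℂ) :
    Prop :=
  ∃ g : E → ℂ, ContDiffOn ℝ ∞ g (Set.range c) ∧ ∀ x, f x = g (c x)

/-- Smooth compactly supported complex functions on `X`, in the coordinates `c`. -/
def SmoothCompact {X E : Type*} [TopologicalSpace X] [NormedAddCommGroup E] [NormedSpace ℝ E]
    (c : X → E) (f : X → ℂ) : Prop :=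
  SmoothIn c f ∧ HasCompactSupport f

/-! ### The Siegel upper half space of degree two and the action of `Sp₄(ℤ)` -/

/-- The Siegel upper half space `ℍ₂`: symmetric complex `2 × 2` matrices with positive definite
imaginary part. -/
def H2 : Type :=
  {Z : Matrix (Fin 2) (Fin 2) ℂ // Zᵀ = Z ∧ (Z.map Complex.im).PosDef}

namespace H2

instance : TopologicalSpace H2 :=
  inferInstanceAs (TopologicalSpace
    {Z : Matrix (Fin 2) (Fin 2) ℂ // Zᵀ = Z ∧ (Z.map Complex.im).PosDef})

instance : MeasurableSpace H2 := borel H2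

instance : BorelSpace H2 := ⟨rfl⟩

/-- The underlying matrix of `Z ∈ ℍ₂`. -/
def mat (Z : H2) : Matrix (Fin 2) (Fin 2) ℂ := Z.1

/-- The real part `X` of `Z = X + iY`. -/
def re (Z : H2) : Matrix (Fin 2) (Fin 2) ℝ := Z.mat.map Complex.re

/-- The imaginary part `Y` of `Z = X + iY`. -/
def im (Z : H2) : Matrix (Fin 2) (Fin 2) ℝ := Z.mat.map Complex.im

/-- The global coordinates `(z₁₁, z₁₂, z₂₂)`, identifying `ℍ₂` with an open subset of `ℂ³`. -/
def coord (Z : H2) : Fin 3 → ℂ := ![Z.mat 0 0, Z.mat 0 1, Z.mat 1 1]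

theorem ext {Z W : H2} (h : Z.mat = W.mat) : Z = W := Subtype.ext h

end H2

/-- `Γ = Sp₄(ℤ)`. -/
abbrev Sp4Z := Matrix.symplecticGroup (Fin 2) ℤ

/-- The numerator `AZ + B` for `γ = (A B; C D)`. -/
def num (γ : Sp4Z) (Z : Matrix (Fin 2) (Fin 2) ℂ) : Matrix (Fin 2) (Fin 2) ℂ :=
  γ.1.toBlocks₁₁.map (Int.cast : ℤ → ℂ) * Z + γ.1.toBlocks₁₂.map (Int.cast : ℤ → ℂ)

/-- The denominator `J(γ, Z) = CZ + D` for `γ = (A B; C D)`. -/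
def den (γ : Sp4Z) (Z : Matrix (Fin 2) (Fin 2) ℂ) : Matrix (Fin 2) (Fin 2) ℂ :=
  γ.1.toBlocks₂₁.map (Int.cast : ℤ → ℂ) * Z + γ.1.toBlocks₂₂.map (Int.cast : ℤ → ℂ)

theorem im_quadForm (Z : H2) (u : Fin 2 → ℂ) (hu : u ≠ 0) :
    0 < (star u ⬝ᵥ (Z.mat *ᵥ u)).im := by
  obtain ⟨M, hs, hp⟩ := Z
  have h01 : M 1 0 = M 0 1 := by
    have := congrFun (congrFun hs 0) 1
    simpa using this
  have hre := hp.posSemidef.dotProduct_mulVec_nonneg (fun i => (u i).re)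
  have him := hp.posSemidef.dotProduct_mulVec_nonneg (fun i => (u i).im)
  have key : (star u ⬝ᵥ (M *ᵥ u)).im =
      star (fun i => (u i).re) ⬝ᵥ (M.map Complex.im *ᵥ (fun i => (u i).re)) +
      star (fun i => (u i).im) ⬝ᵥ (M.map Complex.im *ᵥ (fun i => (u i).im)) := by
    simp [dotProduct, mulVec, Fin.sum_univ_two, h01]
    ring
  change 0 < (star u ⬝ᵥ (M *ᵥ u)).im
  rw [key]
  by_cases h : (fun i => (u i).re) = 0
  · have h2 : (fun i => (u i).im) ≠ 0 := by
      intro h2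
      exact hu (funext fun i => Complex.ext (congrFun h i) (congrFun h2 i))
    have := hp.dotProduct_mulVec_pos h2
    linarith
  · have := hp.dotProduct_mulVec_pos h
    linarith

theorem blocks_rel (γ : Sp4Z) :
    ((γ.1.toBlocks₁₁.map (Int.cast : ℤ → ℂ))ᵀ * γ.1.toBlocks₂₁.map (Int.cast : ℤ → ℂ) =
      (γ.1.toBlocks₂₁.map (Int.cast : ℤ → ℂ))ᵀ * γ.1.toBlocks₁₁.map (Int.cast : ℤ → ℂ)) ∧
    ((γ.1.toBlocks₁₂.map (Int.cast : ℤ → ℂ))ᵀ * γ.1.toBlocks₂₂.map (Int.cast : ℤ → ℂ) =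
      (γ.1.toBlocks₂₂.map (Int.cast : ℤ → ℂ))ᵀ * γ.1.toBlocks₁₂.map (Int.cast : ℤ → ℂ)) ∧
    ((γ.1.toBlocks₁₁.map (Int.cast : ℤ → ℂ))ᵀ * γ.1.toBlocks₂₂.map (Int.cast : ℤ → ℂ) -
      (γ.1.toBlocks₂₁.map (Int.cast : ℤ → ℂ))ᵀ * γ.1.toBlocks₁₂.map (Int.cast : ℤ → ℂ) = 1) := by
  have h := γ.2
  rw [← fromBlocks_toBlocks γ.1, SymplecticGroup.fromBlocks_mem_iff] at h
  obtain ⟨h1, h2, h3⟩ := h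
  have e1 := congrArg (fun M => M.map (Int.castRingHom ℂ)) h1
  have e2 := congrArg (fun M => M.map (Int.castRingHom ℂ)) h2
  have e3 := congrArg (fun M => M.map (Int.castRingHom ℂ)) h3
  simp only [Matrix.map_mul, transpose_map] at e1 e2
  rw [Matrix.map_sub _ (by intro a b; simp)] at e3
  simp only [Matrix.map_mul, transpose_map] at e3
  rw [Matrix.map_one _ (by simp) (by simp)] at e3
  exact ⟨e1, e2, e3⟩

theorem den_transpose_mul_num (γ : Sp4Z) (Z : H2) :
    (den γ Z.mat)ᵀ * num γ Z.mat = (num γ Z.mat)ᵀ * den γ Z.mat := by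
  obtain ⟨h1, h2, h3⟩ := blocks_rel γ
  have h3' := congrArg transpose h3
  have hs : Z.matᵀ = Z.mat := Z.2.1
  simp only [transpose_sub, transpose_mul, transpose_transpose, transpose_one] at h3'
  simp only [num, den, transpose_add, transpose_mul, hs]
  linear_combination (norm := noncomm_ring) -Z.mat * h1 * Z.mat - h2 - Z.mat * h3 + h3' * Z.mat

theorem conj_den_mul_num (γ : Sp4Z) (Z : H2) :
    (den γ Z.mat)ᴴ * num γ Z.mat - (num γ Z.mat)ᴴ * den γ Z.mat = Z.mat - Z.matᴴ := by
  obtain ⟨h1, h2, h3⟩ := blocks_rel γ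
  have h3' := congrArg transpose h3
  simp only [transpose_sub, transpose_mul, transpose_transpose, transpose_one] at h3'
  have hr : ∀ M : Matrix (Fin 2) (Fin 2) ℤ,
      (M.map (Int.cast : ℤ → ℂ))ᴴ = (M.map (Int.cast : ℤ → ℂ))ᵀ := by
    intro M
    ext i j
    simp
  simp only [num, den, conjTranspose_add, conjTranspose_mul, hr]
  linear_combination (norm := noncomm_ring)
    -Z.matᴴ * h1 * Z.mat - h2 - Z.matᴴ * h3 + h3' * Z.mat

theorem im_quadForm_action (γ : Sp4Z) (Z : H2) (u : Fin 2 → ℂ) :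
    (star (den γ Z.mat *ᵥ u) ⬝ᵥ (num γ Z.mat *ᵥ u)).im = (star u ⬝ᵥ (Z.mat *ᵥ u)).im := by
  have adj : ∀ P Q : Matrix (Fin 2) (Fin 2) ℂ,
      star u ⬝ᵥ ((Qᴴ * P - Pᴴ * Q) *ᵥ u) =
        ((2 * (star (Q *ᵥ u) ⬝ᵥ (P *ᵥ u)).im : ℝ) : ℂ) * Complex.I := by
    intro P Q
    apply Complex.ext <;>
    · simp [dotProduct, mulVec, Fin.sum_univ_two, Matrix.mul_apply]
      ring
  have h1 := adj (num γ Z.mat) (den γ Z.mat)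
  have h2 := adj Z.mat 1
  rw [conj_den_mul_num] at h1
  simp only [conjTranspose_one, Matrix.one_mul, Matrix.mul_one, one_mulVec] at h2
  rw [h1] at h2
  have h3 := congrArg Complex.im h2
  simp only [Complex.mul_I_im, Complex.ofReal_re] at h3
  linarith

theorem isUnit_det_den (γ : Sp4Z) (Z : H2) : IsUnit (den γ Z.mat).det := by
  rw [isUnit_iff_ne_zero]
  intro h0
  obtain ⟨u, hu, h⟩ := exists_mulVec_eq_zero_iff.mpr h0
  have h1 := im_quadForm_action γ Z u
  have h2 := im_quadForm Z u hu
  rw [h, star_zero, zero_dotProduct, Complex.zero_im] at h1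
  linarith

theorem action_mem (γ : Sp4Z) (Z : H2) :
    (num γ Z.mat * (den γ Z.mat)⁻¹)ᵀ = num γ Z.mat * (den γ Z.mat)⁻¹ ∧
      ((num γ Z.mat * (den γ Z.mat)⁻¹).map Complex.im).PosDef := by
  have hu := isUnit_det_den γ Z
  have huT : IsUnit ((den γ Z.mat)ᵀ).det := by rwa [det_transpose]
  have hsymm : (num γ Z.mat * (den γ Z.mat)⁻¹)ᵀ = num γ Z.mat * (den γ Z.mat)⁻¹ := by
    rw [transpose_mul, transpose_nonsing_inv]
    calc ((den γ Z.mat)ᵀ)⁻¹ * (num γ Z.mat)ᵀ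
        = ((den γ Z.mat)ᵀ)⁻¹ * ((num γ Z.mat)ᵀ * den γ Z.mat) * (den γ Z.mat)⁻¹ := by
          rw [Matrix.mul_assoc, Matrix.mul_assoc, mul_nonsing_inv _ hu, Matrix.mul_one]
      _ = num γ Z.mat * (den γ Z.mat)⁻¹ := by
          rw [← den_transpose_mul_num, ← Matrix.mul_assoc, nonsing_inv_mul _ huT, Matrix.one_mul]
  refine ⟨hsymm, PosDef.of_dotProduct_mulVec_pos ?_ ?_⟩
  · ext i j
    have := congrFun (congrFun hsymm i) j
    simp only [conjTranspose_apply, map_apply, star_trivial]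
    rw [← this, transpose_apply]
  · intro x hx
    set Q := den γ Z.mat
    set P := num γ Z.mat
    set v : Fin 2 → ℂ := fun i => (x i : ℂ)
    have hv : v ≠ 0 := by
      intro h
      exact hx (funext fun i => by simpa [v] using congrFun h i)
    have hQv : Q *ᵥ (Q⁻¹ *ᵥ v) = v := by
      rw [mulVec_mulVec, mul_nonsing_inv _ hu, one_mulVec]
    have hne : Q⁻¹ *ᵥ v ≠ 0 := by
      intro h
      rw [h, mulVec_zero] at hQv
      exact hv hQv.symm
    have h1 := im_quadForm_action γ Z (Q⁻¹ *ᵥ v)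
    have h2 := im_quadForm Z _ hne
    rw [← h1] at h2
    change 0 < (star (Q *ᵥ (Q⁻¹ *ᵥ v)) ⬝ᵥ (P *ᵥ (Q⁻¹ *ᵥ v))).im at h2
    rw [hQv, mulVec_mulVec] at h2
    have e : (star v ⬝ᵥ ((P * Q⁻¹) *ᵥ v)).im =
        star x ⬝ᵥ ((P * Q⁻¹).map Complex.im *ᵥ x) := by
      generalize P * Q⁻¹ = W
      simp [dotProduct, mulVec, Fin.sum_univ_two, v]
    rwa [e] at h2

theorem toBlocks_mul (γ δ : Sp4Z) :
    (γ * δ).1.toBlocks₁₁ = γ.1.toBlocks₁₁ * δ.1.toBlocks₁₁ + γ.1.toBlocks₁₂ * δ.1.toBlocks₂₁ ∧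
    (γ * δ).1.toBlocks₁₂ = γ.1.toBlocks₁₁ * δ.1.toBlocks₁₂ + γ.1.toBlocks₁₂ * δ.1.toBlocks₂₂ ∧
    (γ * δ).1.toBlocks₂₁ = γ.1.toBlocks₂₁ * δ.1.toBlocks₁₁ + γ.1.toBlocks₂₂ * δ.1.toBlocks₂₁ ∧
    (γ * δ).1.toBlocks₂₂ = γ.1.toBlocks₂₁ * δ.1.toBlocks₁₂ + γ.1.toBlocks₂₂ * δ.1.toBlocks₂₂ := by
  refine ⟨?_, ?_, ?_, ?_⟩ <;>
  · ext i j
    simp [toBlocks₁₁, toBlocks₁₂, toBlocks₂₁, toBlocks₂₂, Matrix.mul_apply]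

theorem map_mul_add (A B C D : Matrix (Fin 2) (Fin 2) ℤ) :
    (A * B + C * D).map (Int.cast : ℤ → ℂ) =
      A.map (Int.cast : ℤ → ℂ) * B.map (Int.cast : ℤ → ℂ) +
        C.map (Int.cast : ℤ → ℂ) * D.map (Int.cast : ℤ → ℂ) := by
  ext i j
  simp [Matrix.mul_apply]

theorem num_mul (γ δ : Sp4Z) (Z : H2) :
    num (γ * δ) Z.mat = num γ (num δ Z.mat * (den δ Z.mat)⁻¹) * den δ Z.mat := by
  have hu := isUnit_det_den δ Z
  obtain ⟨h1, h2, -, -⟩ := toBlocks_mul γ δ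
  have e : num γ (num δ Z.mat * (den δ Z.mat)⁻¹) * den δ Z.mat =
      γ.1.toBlocks₁₁.map (Int.cast : ℤ → ℂ) * num δ Z.mat +
        γ.1.toBlocks₁₂.map (Int.cast : ℤ → ℂ) * den δ Z.mat := by
    rw [num, Matrix.add_mul, Matrix.mul_assoc, Matrix.mul_assoc, nonsing_inv_mul _ hu,
      Matrix.mul_one]
  rw [e, num, h1, h2, map_mul_add, map_mul_add, num, den]
  noncomm_ring

theorem den_mul (γ δ : Sp4Z) (Z : H2) :
    den (γ * δ) Z.mat = den γ (num δ Z.mat * (den δ Z.mat)⁻¹) * den δ Z.mat := by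
  have hu := isUnit_det_den δ Z
  obtain ⟨-, -, h1, h2⟩ := toBlocks_mul γ δ
  have e : den γ (num δ Z.mat * (den δ Z.mat)⁻¹) * den δ Z.mat =
      γ.1.toBlocks₂₁.map (Int.cast : ℤ → ℂ) * num δ Z.mat +
        γ.1.toBlocks₂₂.map (Int.cast : ℤ → ℂ) * den δ Z.mat := by
    rw [den, Matrix.add_mul, Matrix.mul_assoc, Matrix.mul_assoc, nonsing_inv_mul _ hu,
      Matrix.mul_one]
  rw [e, den, h1, h2, map_mul_add, map_mul_add, num, den]
  noncomm_ring

/-- The action `γ⟨Z⟩ = (AZ + B)(CZ + D)⁻¹` of `Sp₄(ℤ)` on `ℍ₂`. -/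
noncomputable instance : MulAction Sp4Z H2 where
  smul γ Z := ⟨num γ Z.mat * (den γ Z.mat)⁻¹, action_mem γ Z⟩
  one_smul Z := by
    apply H2.ext
    change num 1 Z.mat * (den 1 Z.mat)⁻¹ = Z.mat
    have a : ((1 : Sp4Z).1).toBlocks₁₁ = 1 := by
      ext i j; simp [toBlocks₁₁, Matrix.one_apply]
    have b : ((1 : Sp4Z).1).toBlocks₁₂ = 0 := by
      ext i j; simp [toBlocks₁₂]
    have c : ((1 : Sp4Z).1).toBlocks₂₁ = 0 := by
      ext i j; simp [toBlocks₂₁]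
    have d : ((1 : Sp4Z).1).toBlocks₂₂ = 1 := by
      ext i j; simp [toBlocks₂₂, Matrix.one_apply]
    rw [num, den, a, b, c, d]
    simp
  mul_smul γ δ Z := by
    apply H2.ext
    change num (γ * δ) Z.mat * (den (γ * δ) Z.mat)⁻¹ =
      num γ (num δ Z.mat * (den δ Z.mat)⁻¹) * (den γ (num δ Z.mat * (den δ Z.mat)⁻¹))⁻¹
    have hu := isUnit_det_den δ Z
    rw [num_mul, den_mul, Matrix.mul_inv_rev, Matrix.mul_assoc,
      ← Matrix.mul_assoc (den δ Z.mat), mul_nonsing_inv _ hu, Matrix.one_mul]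

theorem smul_mat (γ : Sp4Z) (Z : H2) : (γ • Z).mat = num γ Z.mat * (den γ Z.mat)⁻¹ := rfl

/-- The quotient space `Γ \ ℍ₂`, with the quotient topology. -/
abbrev Quot2 := MulAction.orbitRel.Quotient Sp4Z H2

/-- The projection `ℍ₂ → Γ \ ℍ₂`. -/
noncomputable def proj (Z : H2) : Quot2 := Quotient.mk _ Z

/-- `φ ∈ C_c^∞(Γ \ ℍ₂)`: `φ` has compact support in `Γ \ ℍ₂` and its pull-back to `ℍ₂` is smooth
(smooth functions on an orbifold quotient are the invariant smooth functions upstairs). -/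
def IsCcSmoothQuot (φ : Quot2 → ℂ) : Prop :=
  SmoothIn H2.coord (fun Z => φ (proj Z)) ∧ HasCompactSupport φ

/-! ### The space `𝓜₂ = GL₂(ℝ)⁺ / SO(2)` -/

/-- The matrix entries of an element of `GL₂(ℝ)⁺`. -/
def entries (A : GL(2, ℝ)⁺) : Fin 2 → Fin 2 → ℝ := fun i j => (A : GL (Fin 2) ℝ) i j

/-- The subgroup `SO(2)` of `GL₂(ℝ)⁺`. -/
def SO2 : Subgroup GL(2, ℝ)⁺ where
  carrier := {A | ((A : GL (Fin 2) ℝ) : Matrix (Fin 2) (Fin 2) ℝ) ∈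
    Matrix.specialOrthogonalGroup (Fin 2) ℝ}
  mul_mem' {A B} hA hB := by
    simp only [Set.mem_ofPred_eq, Subgroup.coe_mul, Units.val_mul] at *
    exact mul_mem hA hB
  one_mem' := by
    simp only [Set.mem_ofPred_eq, Subgroup.coe_one, Units.val_one]
    exact one_mem _
  inv_mem' {A} hA := by
    simp only [Set.mem_ofPred_eq] at *
    have h : (((A⁻¹ : GL(2, ℝ)⁺) : GL (Fin 2) ℝ) : Matrix (Fin 2) (Fin 2) ℝ) =
        star ((A : GL (Fin 2) ℝ) : Matrix (Fin 2) (Fin 2) ℝ) := by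
      rw [Subgroup.coe_inv, coe_units_inv]
      exact inv_eq_left_inv (mem_specialUnitaryGroup_iff.mp hA).1.1
    rw [h]
    obtain ⟨h1, h2⟩ := mem_specialUnitaryGroup_iff.mp hA
    refine mem_specialUnitaryGroup_iff.mpr ⟨Unitary.star_mem h1, ?_⟩
    rw [star_eq_conjTranspose, det_conjTranspose, h2, star_one]

/-- `𝓜₂ = GL₂(ℝ)⁺ / SO(2)`, with the quotient topology. -/
abbrev M2 := GL(2, ℝ)⁺ ⧸ SO2

/-- `h ∈ C_c^∞(𝓜₂)`: `h` has compact support in `𝓜₂` and its pull-back to `GL₂(ℝ)⁺`, an open subset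
of the space of real `2 × 2` matrices, is smooth. -/
def IsCcSmoothM2 (h : M2 → ℂ) : Prop :=
  SmoothIn entries (fun A => h (A : M2)) ∧ HasCompactSupport h

/-- The space of positive definite symmetric real `2 × 2` matrices. -/
abbrev SymPos := {Y : Matrix (Fin 2) (Fin 2) ℝ // Y.PosDef}

theorem mul_transpose_posDef (A : GL(2, ℝ)⁺) :
    (((A : GL (Fin 2) ℝ) : Matrix (Fin 2) (Fin 2) ℝ) *
      ((A : GL (Fin 2) ℝ) : Matrix (Fin 2) (Fin 2) ℝ)ᵀ).PosDef := by
  have hu : IsUnit ((A : GL (Fin 2) ℝ) : Matrix (Fin 2) (Fin 2) ℝ) := (A : GL (Fin 2) ℝ).isUnit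
  have := Matrix.PosDef.mul_conjTranspose_self
    ((A : GL (Fin 2) ℝ) : Matrix (Fin 2) (Fin 2) ℝ) (vecMul_injective_of_isUnit hu)
  rwa [conjTranspose_eq_transpose_of_trivial] at this

theorem mul_transpose_eq_of_rel (A B : GL(2, ℝ)⁺) (h : A⁻¹ * B ∈ SO2) :
    ((A : GL (Fin 2) ℝ) : Matrix (Fin 2) (Fin 2) ℝ) *
      ((A : GL (Fin 2) ℝ) : Matrix (Fin 2) (Fin 2) ℝ)ᵀ =
    ((B : GL (Fin 2) ℝ) : Matrix (Fin 2) (Fin 2) ℝ) *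
      ((B : GL (Fin 2) ℝ) : Matrix (Fin 2) (Fin 2) ℝ)ᵀ := by
  obtain ⟨K, hK⟩ : ∃ K, K = A⁻¹ * B := ⟨_, rfl⟩
  have hB : B = A * K := by rw [hK]; group
  rw [← hK] at h
  have hk : ((K : GL (Fin 2) ℝ) : Matrix (Fin 2) (Fin 2) ℝ) *
      ((K : GL (Fin 2) ℝ) : Matrix (Fin 2) (Fin 2) ℝ)ᵀ = 1 := by
    have := (mem_specialUnitaryGroup_iff.mp h).1.2
    rwa [star_eq_conjTranspose, conjTranspose_eq_transpose_of_trivial] at this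
  rw [hB]
  simp only [Subgroup.coe_mul, Units.val_mul, transpose_mul]
  rw [Matrix.mul_assoc, ← Matrix.mul_assoc (((K : GL (Fin 2) ℝ) : Matrix (Fin 2) (Fin 2) ℝ)),
    hk, Matrix.one_mul]

/-- The map `ι : 𝓜₂ → M₂^Sym(ℝ)⁺`, `ι(A) = A ᵗA`. -/
noncomputable def iota : M2 → SymPos :=
  Quotient.lift (fun A : GL(2, ℝ)⁺ =>
    (⟨((A : GL (Fin 2) ℝ) : Matrix (Fin 2) (Fin 2) ℝ) *
      ((A : GL (Fin 2) ℝ) : Matrix (Fin 2) (Fin 2) ℝ)ᵀ, mul_transpose_posDef A⟩ : SymPos))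
    (fun A B h => Subtype.ext (mul_transpose_eq_of_rel A B (QuotientGroup.leftRel_apply.mp h)))

/-- The upper triangular matrix `(1 u; 0 1) · diag(√t₁, √t₂)` in `GL₂(ℝ)⁺`. -/
noncomputable def triangular (t₁ t₂ : Set.Ioi (0 : ℝ)) (u : ℝ) : GL(2, ℝ)⁺ :=
  have hd : (!![(1 : ℝ), u; 0, 1] * !![√t₁.1, 0; 0, √t₂.1]).det = √t₁.1 * √t₂.1 := by
    simp [det_fin_two]
  have hp : 0 < √t₁.1 * √t₂.1 := mul_pos (Real.sqrt_pos.mpr t₁.2) (Real.sqrt_pos.mpr t₂.2)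
  ⟨GeneralLinearGroup.mkOfDetNeZero (!![(1 : ℝ), u; 0, 1] * !![√t₁.1, 0; 0, √t₂.1])
    (by rw [hd]; exact hp.ne'), by
    rw [mem_glpos, GeneralLinearGroup.val_det_apply]
    exact hp.trans_eq hd.symm⟩

theorem iota_bijective : Function.Bijective iota := by
  constructor
  · intro a b
    refine Quotient.inductionOn₂ a b ?_
    intro A B h
    have h' : ((A : GL (Fin 2) ℝ) : Matrix (Fin 2) (Fin 2) ℝ) *
        ((A : GL (Fin 2) ℝ) : Matrix (Fin 2) (Fin 2) ℝ)ᵀ =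
        ((B : GL (Fin 2) ℝ) : Matrix (Fin 2) (Fin 2) ℝ) *
        ((B : GL (Fin 2) ℝ) : Matrix (Fin 2) (Fin 2) ℝ)ᵀ := congrArg Subtype.val h
    refine Quotient.sound (QuotientGroup.leftRel_apply.mpr ?_)
    obtain ⟨K, hK⟩ : ∃ K, K = A⁻¹ * B := ⟨_, rfl⟩
    have hB : B = A * K := by rw [hK]; group
    rw [← hK]
    rw [hB] at h'
    simp only [Subgroup.coe_mul, Units.val_mul, transpose_mul] at h'
    have hu : IsUnit ((A : GL (Fin 2) ℝ) : Matrix (Fin 2) (Fin 2) ℝ) :=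
      (A : GL (Fin 2) ℝ).isUnit
    have huT : IsUnit ((A : GL (Fin 2) ℝ) : Matrix (Fin 2) (Fin 2) ℝ)ᵀ :=
      (isUnit_transpose _).mpr hu
    have hk : ((K : GL (Fin 2) ℝ) : Matrix (Fin 2) (Fin 2) ℝ) *
        ((K : GL (Fin 2) ℝ) : Matrix (Fin 2) (Fin 2) ℝ)ᵀ = 1 := by
      apply hu.mul_left_cancel
      apply huT.mul_right_cancel
      rw [Matrix.mul_one, h']
      simp only [Matrix.mul_assoc]
    have hdet : ((K : GL (Fin 2) ℝ) : Matrix (Fin 2) (Fin 2) ℝ).det = 1 := by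
      have hpos : 0 < ((K : GL (Fin 2) ℝ) : Matrix (Fin 2) (Fin 2) ℝ).det := K.2
      have := congrArg det hk
      rw [det_mul, det_transpose, det_one] at this
      nlinarith
    refine mem_specialUnitaryGroup_iff.mpr ⟨mem_unitaryGroup_iff.mpr ?_, hdet⟩
    rwa [star_eq_conjTranspose, conjTranspose_eq_transpose_of_trivial]
  · rintro ⟨Y, hY⟩
    have h01 : Y 1 0 = Y 0 1 := by
      have := congrFun (congrFun hY.isHermitian 0) 1
      simpa using this
    have hdet := hY.det_pos
    have h11 : 0 < Y 1 1 := hY.diag_pos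
    rw [det_fin_two, h01] at hdet
    refine ⟨(triangular ⟨(Y 0 0 * Y 1 1 - Y 0 1 * Y 0 1) / Y 1 1, div_pos hdet h11⟩
      ⟨Y 1 1, h11⟩ (Y 0 1 / Y 1 1) : GL(2, ℝ)⁺), Subtype.ext ?_⟩
    change (!![(1 : ℝ), Y 0 1 / Y 1 1; 0, 1] *
      !![√((Y 0 0 * Y 1 1 - Y 0 1 * Y 0 1) / Y 1 1), 0; 0, √(Y 1 1)]) *
      (!![(1 : ℝ), Y 0 1 / Y 1 1; 0, 1] *
      !![√((Y 0 0 * Y 1 1 - Y 0 1 * Y 0 1) / Y 1 1), 0; 0, √(Y 1 1)])ᵀ = Y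
    have s1 := Real.mul_self_sqrt (div_pos hdet h11).le
    have s2 := Real.mul_self_sqrt h11.le
    generalize √((Y 0 0 * Y 1 1 - Y 0 1 * Y 0 1) / Y 1 1) = a at *
    generalize √(Y 1 1) = b at *
    ext i j
    fin_cases i <;> fin_cases j <;>
      simp [Matrix.mul_apply, Fin.sum_univ_two, h01, s1, s2]
    · have e : Y 0 1 / Y 1 1 * b * (Y 0 1 / Y 1 1 * b) =
          (Y 0 1 / Y 1 1) * (Y 0 1 / Y 1 1) * Y 1 1 := by rw [← s2]; ring
      rw [e]
      field_simp
      ring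
    · rw [mul_assoc, s2]
      field_simp
    · rw [mul_comm, mul_assoc, s2]
      field_simp

/-- The bijection `ι : 𝓜₂ ≃ M₂^Sym(ℝ)⁺`. -/
noncomputable def iotaEquiv : M2 ≃ SymPos := Equiv.ofBijective iota iota_bijective

/-! ### Siegel–Poincaré series -/

/-- The set `Λ₂` of semi-integral symmetric matrices. -/
def Lambda2 : Set (Matrix (Fin 2) (Fin 2) ℝ) :=
  {S | ∃ m r n : ℤ, S = !![(m : ℝ), (r : ℝ) / 2; (r : ℝ) / 2, (n : ℝ)]}

/-- `e(x) = exp(2πix)`. -/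
noncomputable def e (x : ℝ) : ℂ := Complex.exp (2 * Real.pi * Complex.I * x)

/-- The imaginary part of `Z ∈ ℍ₂` as a positive definite matrix. -/
def imPos (Z : H2) : SymPos := ⟨Z.im, Z.2.2⟩

/-- `h_S(Z) = e(Tr(SX)) h(ι⁻¹(Y))` for `Z = X + iY`. -/
noncomputable def hS (h : M2 → ℂ) (S : Lambda2) (Z : H2) : ℂ :=
  e (S.1 * Z.re).trace * h (iotaEquiv.symm (imPos Z))

/-- The block matrix `(1 X; 0 1)`, over the integers. -/
def nMat (X : Matrix (Fin 2) (Fin 2) ℤ) : Matrix (Fin 2 ⊕ Fin 2) (Fin 2 ⊕ Fin 2) ℤ :=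
  fromBlocks 1 X 0 1

/-- `Γ_∞ = {n(X) : X ∈ M₂^Sym(ℤ)}`. -/
def GammaInf : Subgroup Sp4Z where
  carrier := {γ | ∃ X : Matrix (Fin 2) (Fin 2) ℤ, Xᵀ = X ∧ γ.1 = nMat X}
  mul_mem' := by
    rintro a b ⟨X, hX, ha⟩ ⟨Y, hY, hb⟩
    refine ⟨X + Y, by rw [transpose_add, hX, hY], ?_⟩
    rw [Submonoid.coe_mul, ha, hb, nMat, nMat, nMat, fromBlocks_multiply]
    simp [add_comm]
  one_mem' := ⟨0, by simp, by simp [nMat]⟩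
  inv_mem' := by
    rintro a ⟨X, hX, ha⟩
    refine ⟨-X, by rw [transpose_neg, hX], ?_⟩
    rw [SymplecticGroup.coe_inv', ha]
    apply inv_eq_left_inv
    rw [nMat, nMat, fromBlocks_multiply]
    simp

theorem smul_mat_of_mem (n : Sp4Z) (X : Matrix (Fin 2) (Fin 2) ℤ) (h : n.1 = nMat X) (Z : H2) :
    (n • Z).mat = Z.mat + X.map (Int.cast : ℤ → ℂ) := by
  rw [smul_mat, num, den, h]
  simp [nMat]

theorem hS_smul_of_mem (h : M2 → ℂ) (S : Lambda2) {n : Sp4Z} (hn : n ∈ GammaInf) (Z : H2) :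
    hS h S (n • Z) = hS h S Z := by
  obtain ⟨X, hX, hn⟩ := hn
  have hm := smul_mat_of_mem n X hn Z
  have him : imPos (n • Z) = imPos Z := by
    apply Subtype.ext
    ext i j
    simp [imPos, H2.im, hm]
  obtain ⟨S, m, r, k, rfl⟩ := S
  have h01 : X 1 0 = X 0 1 := by
    have := congrFun (congrFun hX 0) 1
    simpa using this
  have htr : (!![(m : ℝ), (r : ℝ) / 2; (r : ℝ) / 2, (k : ℝ)] * (n • Z).re).trace =
      (!![(m : ℝ), (r : ℝ) / 2; (r : ℝ) / 2, (k : ℝ)] * Z.re).trace +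
        ((m * X 0 0 + r * X 0 1 + k * X 1 1 : ℤ) : ℝ) := by
    simp only [trace_fin_two, Matrix.mul_apply, Fin.sum_univ_two, H2.re, hm]
    simp [h01]
    ring
  unfold hS
  rw [him]
  congr 1
  dsimp only
  rw [htr]
  unfold e
  generalize (m * X 0 0 + r * X 0 1 + k * X 1 1 : ℤ) = N
  rw [Complex.exp_eq_exp_iff_exists_int]
  refine ⟨N, ?_⟩
  push_cast
  ring

/-- The coset space `Γ_∞ \ Γ`. -/
abbrev Cosets := Quotient (QuotientGroup.rightRel GammaInf)

/-- The summand `h_S(γZ)` of the Poincaré series, for a coset `Γ_∞ γ`. -/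
noncomputable def poincareTerm (h : M2 → ℂ) (S : Lambda2) (Z : H2) : Cosets → ℂ :=
  Quotient.lift (fun γ : Sp4Z => hS h S (γ • Z)) (by
    intro a b hab
    have hab' : b * a⁻¹ ∈ GammaInf := QuotientGroup.rightRel_apply.mp hab
    have := hS_smul_of_mem h S hab' (a • Z)
    rw [← mul_smul, inv_mul_cancel_right] at this
    exact this.symm)

/-- Right translation `Γ_∞ δ ↦ Γ_∞ δ γ` on `Γ_∞ \ Γ`. -/
def cosetMul (γ : Sp4Z) : Cosets → Cosets :=
  Quotient.map (fun δ => δ * γ) (by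
    intro a b hab
    have hab' : b * a⁻¹ ∈ GammaInf := QuotientGroup.rightRel_apply.mp hab
    refine QuotientGroup.rightRel_apply.mpr ?_
    have : b * γ * (a * γ)⁻¹ = b * a⁻¹ := by group
    rwa [this])

/-- Right translation by `γ` as a permutation of `Γ_∞ \ Γ`. -/
def cosetEquiv (γ : Sp4Z) : Cosets ≃ Cosets where
  toFun := cosetMul γ
  invFun := cosetMul γ⁻¹
  left_inv := by
    intro q
    refine Quotient.inductionOn q ?_
    intro a
    simp [cosetMul]
  right_inv := by
    intro q
    refine Quotient.inductionOn q ?_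
    intro a
    simp [cosetMul]

/-- The Poincaré series on `ℍ₂`: the (finite) sum of `h_S(γZ)` over `γ ∈ Γ_∞ \ Γ`. -/
noncomputable def poincareH2 (h : M2 → ℂ) (S : Lambda2) (Z : H2) : ℂ :=
  ∑ᶠ q : Cosets, poincareTerm h S Z q

theorem poincareH2_smul (h : M2 → ℂ) (S : Lambda2) (γ : Sp4Z) (Z : H2) :
    poincareH2 h S (γ • Z) = poincareH2 h S Z := by
  unfold poincareH2
  rw [← finsum_comp_equiv (cosetEquiv γ) (f := poincareTerm h S Z)]
  refine finsum_congr fun q => ?_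
  refine Quotient.inductionOn q ?_
  intro a
  change hS h S (a • γ • Z) = hS h S ((a * γ) • Z)
  rw [mul_smul]

/-- The incomplete Siegel–Poincaré series `P_S^h` as a function on `Γ \ ℍ₂`. -/
noncomputable def poincare (h : M2 → ℂ) (S : Lambda2) : Quot2 → ℂ :=
  Quotient.lift (poincareH2 h S) (by
    rintro a b ⟨γ, rfl⟩
    exact poincareH2_smul h S γ b)

/-! ### Factorizable functions on `𝓜₂` -/

/-- `R₁`: the functions `h(A) = ψ₁(A·i) ψ₂(det A)` with `ψ₁ ∈ C_c^∞(ℍ)`, `ψ₂ ∈ C_c^∞(ℝ⁺)`. -/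
def R1 : Set (M2 → ℂ) :=
  {h | ∃ (ψ₁ : ℍ → ℂ) (ψ₂ : Set.Ioi (0 : ℝ) → ℂ),
    SmoothCompact (fun z : ℍ => (z : ℂ)) ψ₁ ∧ SmoothCompact Subtype.val ψ₂ ∧
    ∀ A : GL(2, ℝ)⁺, h (A : M2) =
      ψ₁ ((A : GL (Fin 2) ℝ) • I) * ψ₂ ⟨((A : GL (Fin 2) ℝ) : Matrix (Fin 2) (Fin 2) ℝ).det, A.2⟩}

/-- `R₂`: the functions `h((1 u; 0 1) diag(√t₁, √t₂) k) = φ₁(t₁) φ₂(t₂) φ₃(u)`, `k ∈ SO(2)`, with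
`φ₁, φ₂ ∈ C_c^∞(ℝ⁺)` and `φ₃ ∈ C_c^∞(ℝ)`. -/
def R2 : Set (M2 → ℂ) :=
  {h | ∃ (φ₁ φ₂ : Set.Ioi (0 : ℝ) → ℂ) (φ₃ : ℝ → ℂ),
    SmoothCompact Subtype.val φ₁ ∧ SmoothCompact Subtype.val φ₂ ∧
    SmoothCompact (fun u : ℝ => u) φ₃ ∧
    ∀ (t₁ t₂ : Set.Ioi (0 : ℝ)) (u : ℝ), h (triangular t₁ t₂ u : M2) = φ₁ t₁ * φ₂ t₂ * φ₃ u}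

/-! ### Cusp forms and the functionals `D_F` -/

/-- The diagonal matrix `diag(z, w)` as a point of `ℍ₂`. -/
def diagPoint (z w : ℍ) : H2 :=
  ⟨!![(z : ℂ), 0; 0, (w : ℂ)], by ext i j; fin_cases i <;> fin_cases j <;> simp, by
    have h : (!![(z : ℂ), 0; 0, (w : ℂ)]).map Complex.im = Matrix.diagonal ![z.im, w.im] := by
      ext i j; fin_cases i <;> fin_cases j <;> simp
    rw [h]
    refine PosDef.diagonal ?_
    intro i
    fin_cases i
    · exact z.im_pos
    · exact w.im_pos⟩

/-- `F ∈ S_k(Γ)`: `F` is holomorphic on `ℍ₂`, satisfies `F(γ⟨Z⟩) = det(CZ + D)^k F(Z)` for all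
`γ ∈ Γ`, and vanishes at the cusps, i.e. it is killed by the Siegel operator:
`F(diag(z, w)) → 0` as `Im w → ∞`, for each `z ∈ ℍ`. (All one-dimensional cusps of `Γ = Sp₄(ℤ)` are
equivalent.) -/
structure IsCuspForm (k : ℤ) (F : H2 → ℂ) : Prop where
  holomorphic : ∃ g : (Fin 3 → ℂ) → ℂ,
    DifferentiableOn ℂ g (Set.range H2.coord) ∧ ∀ Z, F Z = g (H2.coord Z)
  modular : ∀ (γ : Sp4Z) (Z : H2), F (γ • Z) = (den γ Z.mat).det ^ k * F Z
  cuspidal : ∀ z : ℍ, Tendsto (fun w : ℍ => F (diagPoint z w)) atImInfty (𝓝 0)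

/-- The invariant measure `dμ = (det Y)⁻³ dX dY` on `ℍ₂`; here `dX dY` is Lebesgue measure in the
coordinates `(z₁₁, z₁₂, z₂₂) ∈ ℂ³`. -/
noncomputable def mu : Measure H2 :=
  (Measure.comap H2.coord volume).withDensity (fun Z => ENNReal.ofReal ((Z.im.det ^ 3)⁻¹))

/-- The standard (Siegel) fundamental domain for `Γ \ ℍ₂`: `|det(CZ + D)| ≥ 1` for all
`γ = (A B; C D) ∈ Γ`, `Y` is Minkowski reduced, and `|x_{ij}| ≤ 1/2`. Integrals over `Γ \ ℍ₂` are
integrals over this domain. -/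
def fundDomain : Set H2 :=
  {Z | (∀ γ : Sp4Z, 1 ≤ ‖(den γ Z.mat).det‖) ∧
    (0 ≤ 2 * Z.im 0 1 ∧ 2 * Z.im 0 1 ≤ Z.im 0 0 ∧ Z.im 0 0 ≤ Z.im 1 1) ∧
    ∀ i j, |Z.re i j| ≤ 1 / 2}

/-- `μ_F(φ) = ∫_{Γ \ ℍ₂} |F(Z)|² φ(Z) (det Y)^k dμ`. -/
noncomputable def muF (k : ℤ) (F : H2 → ℂ) (φ : Quot2 → ℂ) : ℂ :=
  ∫ Z in fundDomain, ((‖F Z‖ ^ 2 * Z.im.det ^ k : ℝ) : ℂ) * φ (proj Z) ∂mu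

/-- `D_F(φ) = μ_F(φ) / μ_F(1) - vol(Γ \ ℍ₂)⁻¹ ∫_{Γ \ ℍ₂} φ dμ`. -/
noncomputable def DF (k : ℤ) (F : H2 → ℂ) (φ : Quot2 → ℂ) : ℂ :=
  muF k F φ / muF k F (fun _ => 1) -
    (∫ Z in fundDomain, φ (proj Z) ∂mu) / ((mu fundDomain).toReal : ℂ)

end SiegelPoincare

/-!
The Poincaré series are the coset sums over `Γ_∞ \ Γ` of the `Γ_∞`-invariant functions `h_S`.

*Local finiteness.* The hermitian form of `Im γ⟨Z⟩` at the columns of `CZ + D` gives the diagonal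
entries of `Im Z`, so if `Z` and `Im γ⟨Z⟩` stay in compact sets, then the integral matrices `C`, `D`
are bounded; since `(C, D)` determines the coset, only finitely many cosets occur
(`finite_cosets`). Hence a Poincaré series is locally a finite sum of smooth functions, and its
support is closed and is covered by the image of `{X ∈ [0, 1], Y ∈ K}`, so that it is compact
(`isCcSmoothQuot_poincare`).

*Density.* A compactly supported continuous `φ` on `Γ \ ℍ₂` is the coset sum of a `Γ_∞`-invariant
function `G` with `Y` confined to a compact set, namely of `φ` times a cut-off function of `Y`
divided by the coset sum of that cut-off function (`exists_unfolding`). Such a `G` is a continuous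
function on a torus in `X` with values depending on `Y`; it is uniformly approximated by finite sums
of terms `e(Tr(SX)) g_S(Y)` by a partition of unity in `Y` and the density of trigonometric
polynomials. A second partition of unity, in the coordinates `(log t₁, log t₂, u)` or in the
coordinates `(log Im(A·i), log det A, Re(A·i))`, replaces each `g_S` by a sum of products of
functions of one variable, which lies in the span of `R₂` or `R₁`, whichever is prescribed for `S`
(`mem_approxSpan`). As all supports stay in a fixed compact set, a uniform error `ε` before summation
over cosets becomes an error `O(ε)` after it (`norm_cosetSum_le`, `exists_poincare_approx`).

*Equidistribution.* `D_F(φ)` is the difference of two averages of `φ` over the fundamental domain,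
one with the weight `|F|² (det Y)^k` and one with constant weight, so `|D_F(φ)| ≤ 2 sup |φ|` and
the hypothesis passes from Poincaré series to all compactly supported continuous functions. The
fundamental domain has finite volume (`mu_fundDomain_lt_top`), so there are cut-off functions whose
constant-weight average is near `1`. By hypothesis their averages with weight `|F|² (det Y)^k` are
eventually near `1` too: no mass escapes to the cusp, and the convergence extends to bounded
continuous functions (`tendsto_avgDiff_of_cutoff`). This argument uses only that the weights are
non-negative; that they are integrable with non-zero integral for large `i` is part of what it
yields.
-/

namespace SiegelPoincare

/-! ### Coordinates on the Siegel upper half space -/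

theorem H2.mat_one_zero (Z : H2) : Z.mat 1 0 = Z.mat 0 1 := by
  have := congrFun (congrFun Z.2.1 0) 1
  rwa [transpose_apply] at this

theorem posDef_fin_two_iff {Y : Matrix (Fin 2) (Fin 2) ℝ} (hs : Y 1 0 = Y 0 1) :
    Y.PosDef ↔ 0 < Y 1 1 ∧ 0 < Y 0 0 * Y 1 1 - Y 0 1 * Y 0 1 := by
  constructor
  · intro h
    have := h.det_pos
    rw [det_fin_two, hs] at this
    exact ⟨h.diag_pos, this⟩
  · rintro ⟨h1, h2⟩
    refine PosDef.of_dotProduct_mulVec_pos ?_ ?_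
    · ext i j
      fin_cases i <;> fin_cases j <;> simp [hs]
    · intro x hx
      have key : Y 1 1 * (star x ⬝ᵥ (Y *ᵥ x)) =
          (Y 0 1 * x 0 + Y 1 1 * x 1) ^ 2 + (Y 0 0 * Y 1 1 - Y 0 1 * Y 0 1) * x 0 ^ 2 := by
        simp [dotProduct, mulVec, Fin.sum_univ_two, hs]
        ring
      refine pos_of_mul_pos_right (a := Y 1 1) ?_ h1.le
      rw [key]
      by_cases h0 : x 0 = 0
      · have hx1 : x 1 ≠ 0 := by
          intro h
          exact hx (funext fun i => by fin_cases i <;> assumption)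
        rw [h0]
        have : 0 < (Y 1 1 * x 1) ^ 2 := by positivity
        simpa using this
      · have : 0 < (Y 0 0 * Y 1 1 - Y 0 1 * Y 0 1) * x 0 ^ 2 := by positivity
        positivity

/-- The symmetric matrix with coordinates `(c₀, c₁, c₂)`. -/
def symMat {R : Type*} (c : Fin 3 → R) : Matrix (Fin 2) (Fin 2) R := !![c 0, c 1; c 1, c 2]

theorem symMat_coord (Z : H2) : symMat Z.coord = Z.mat := by
  have := Z.mat_one_zero
  ext i j
  fin_cases i <;> fin_cases j <;> simp [symMat, H2.coord, this]

theorem coord_injective : Function.Injective H2.coord := fun Z W h =>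
  H2.ext (by rw [← symMat_coord, h, symMat_coord])

/-- The image of `ℍ₂` under the coordinates `(z₁₁, z₁₂, z₂₂)`. -/
theorem range_coord : Set.range H2.coord =
    {c : Fin 3 → ℂ | 0 < (c 2).im ∧ 0 < (c 0).im * (c 2).im - (c 1).im * (c 1).im} := by
  ext c
  have hs : ((symMat c).map Complex.im) 1 0 = ((symMat c).map Complex.im) 0 1 := by simp [symMat]
  constructor
  · rintro ⟨Z, rfl⟩
    have := Z.2.2
    change (Z.mat.map Complex.im).PosDef at this
    rw [← symMat_coord, posDef_fin_two_iff (by simp [symMat])] at this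
    simpa [symMat] using this
  · intro hc
    refine ⟨⟨symMat c, ?_, (posDef_fin_two_iff hs).mpr (by simpa [symMat] using hc)⟩, ?_⟩
    · ext i j; fin_cases i <;> fin_cases j <;> simp [symMat]
    · ext i; fin_cases i <;> simp [symMat, H2.coord, H2.mat]

theorem isOpen_range_coord : IsOpen (Set.range H2.coord) := by
  rw [range_coord]
  have h : ∀ i, Continuous fun c : Fin 3 → ℂ => (c i).im := fun i => by fun_prop
  exact (isOpen_lt continuous_const (h 2)).inter
    (isOpen_lt continuous_const (((h 0).mul (h 2)).sub ((h 1).mul (h 1))))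

theorem continuous_mat : Continuous H2.mat := continuous_subtype_val

theorem continuous_coord : Continuous H2.coord := by
  refine continuous_pi fun i => ?_
  fin_cases i <;> exact continuous_mat.matrix_elem _ _

theorem isInducing_mat : IsInducing H2.mat := IsInducing.subtypeVal

theorem isOpenEmbedding_coord : IsOpenEmbedding H2.coord := by
  refine ⟨⟨?_, coord_injective⟩, isOpen_range_coord⟩
  have h1 : Continuous (symMat : (Fin 3 → ℂ) → Matrix (Fin 2) (Fin 2) ℂ) := by
    refine continuous_matrix fun i j => ?_
    fin_cases i <;> fin_cases j <;> simp [symMat] <;> fun_prop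
  refine IsInducing.of_comp continuous_coord h1 ?_
  convert isInducing_mat using 1
  exact funext symMat_coord

instance : LocallyCompactSpace H2 := isOpenEmbedding_coord.locallyCompactSpace

theorem continuous_im : Continuous H2.im := continuous_mat.matrix_map Complex.continuous_im

theorem continuous_re : Continuous H2.re := continuous_mat.matrix_map Complex.continuous_re

theorem continuous_imPos : Continuous imPos := continuous_im.subtype_mk _

theorem continuous_smul (γ : Sp4Z) : Continuous fun Z : H2 => γ • Z := by
  rw [isInducing_mat.continuous_iff]
  have hd : Continuous fun Z : H2 => den γ Z.mat := by
    unfold den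
    exact (continuous_const.matrix_mul continuous_mat).add continuous_const
  have hn : Continuous fun Z : H2 => SiegelPoincare.num γ Z.mat := by
    unfold SiegelPoincare.num
    exact (continuous_const.matrix_mul continuous_mat).add continuous_const
  have hi : Continuous fun Z : H2 => (den γ Z.mat)⁻¹ := by
    have : (fun Z : H2 => (den γ Z.mat)⁻¹) =
        fun Z : H2 => ((den γ Z.mat).det)⁻¹ • (den γ Z.mat).adjugate := by
      funext Z
      rw [Matrix.inv_def, Ring.inverse_eq_inv]
    rw [this]
    exact (hd.matrix_det.inv₀ fun Z => (isUnit_det_den γ Z).ne_zero).smul hd.matrix_adjugate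
  exact hn.matrix_mul hi

instance : ContinuousConstSMul Sp4Z H2 := ⟨continuous_smul⟩

theorem continuous_proj : Continuous proj := continuous_quotient_mk'

theorem isOpenMap_proj : IsOpenMap proj := isOpenMap_quotient_mk'_mul

theorem proj_smul (γ : Sp4Z) (Z : H2) : proj (γ • Z) = proj Z :=
  Quotient.sound ⟨γ, rfl⟩

theorem proj_eq_iff {Z W : H2} : proj Z = proj W ↔ ∃ γ : Sp4Z, γ • W = Z := by
  unfold proj
  rw [Quotient.eq]
  rfl

theorem proj_surjective : Function.Surjective proj := Quotient.mk_surjective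

/-! ### Local finiteness of the coset sums -/

theorem smul_mul_den (γ : Sp4Z) (Z : H2) :
    (γ • Z).mat * den γ Z.mat = SiegelPoincare.num γ Z.mat := by
  rw [smul_mat, Matrix.mul_assoc, nonsing_inv_mul _ (isUnit_det_den γ Z), Matrix.mul_one]

/-- Two elements of `Γ` with the same lower blocks `C`, `D` lie in the same coset of `Γ_∞`. -/
theorem mul_inv_mem_gammaInf_of_bottom_eq {γ δ : Sp4Z} (h1 : γ.1.toBlocks₂₁ = δ.1.toBlocks₂₁)
    (h2 : γ.1.toBlocks₂₂ = δ.1.toBlocks₂₂) : δ * γ⁻¹ ∈ GammaInf := by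
  set n := δ * γ⁻¹ with hn
  have hδ : δ = n * γ := by rw [hn, inv_mul_cancel_right]
  have hγ1 : (γ * γ⁻¹).1 = 1 := by rw [mul_inv_cancel]; rfl
  have e3 : n.1.toBlocks₂₁ = 0 := by
    rw [hn, (toBlocks_mul δ γ⁻¹).2.2.1, ← h1, ← h2, ← (toBlocks_mul γ γ⁻¹).2.2.1, hγ1]
    ext i j; simp [toBlocks₂₁]
  have e4 : n.1.toBlocks₂₂ = 1 := by
    rw [hn, (toBlocks_mul δ γ⁻¹).2.2.2, ← h1, ← h2, ← (toBlocks_mul γ γ⁻¹).2.2.2, hγ1]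
    ext i j; simp [toBlocks₂₂, Matrix.one_apply]
  have hm := n.2
  rw [← fromBlocks_toBlocks n.1, SymplecticGroup.fromBlocks_mem_iff, e3, e4] at hm
  obtain ⟨-, m2, m3⟩ := hm
  have e1 : n.1.toBlocks₁₁ = 1 := by
    simpa using congrArg transpose m3
  refine ⟨n.1.toBlocks₁₂, by simpa using m2, ?_⟩
  rw [nMat]
  conv_lhs => rw [← fromBlocks_toBlocks n.1, e1, e3, e4]


/-- For `Y = Im W` this is the operator inequality `det Y ≤ tr Y · Y`, which holds because
`tr Y · Y - det Y = Y²` is positive semidefinite. -/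
theorem det_mul_normSq_le (W : H2) (v : Fin 2 → ℂ) :
    W.im.det * (‖v 0‖ ^ 2 + ‖v 1‖ ^ 2) ≤ W.im.trace * (star v ⬝ᵥ (W.mat *ᵥ v)).im := by
  have hs := W.mat_one_zero
  have hs' : W.im 1 0 = W.im 0 1 := by simp [H2.im, hs]
  have key : W.im.trace * (star v ⬝ᵥ (W.mat *ᵥ v)).im =
      W.im.det * (‖v 0‖ ^ 2 + ‖v 1‖ ^ 2) +
      ((W.im 0 0 * (v 0).re + W.im 0 1 * (v 1).re) ^ 2 +
      (W.im 0 1 * (v 0).re + W.im 1 1 * (v 1).re) ^ 2 +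
      (W.im 0 0 * (v 0).im + W.im 0 1 * (v 1).im) ^ 2 +
      (W.im 0 1 * (v 0).im + W.im 1 1 * (v 1).im) ^ 2) := by
    rw [det_fin_two, trace_fin_two, hs', ← Complex.normSq_eq_norm_sq, ← Complex.normSq_eq_norm_sq]
    simp [dotProduct, mulVec, Fin.sum_univ_two, H2.im, hs, Complex.normSq_apply]
    ring
  rw [key]
  have : 0 ≤ ((W.im 0 0 * (v 0).re + W.im 0 1 * (v 1).re) ^ 2 +
      (W.im 0 1 * (v 0).re + W.im 1 1 * (v 1).re) ^ 2 +
      (W.im 0 0 * (v 0).im + W.im 0 1 * (v 1).im) ^ 2 +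
      (W.im 0 1 * (v 0).im + W.im 1 1 * (v 1).im) ^ 2) := by positivity
  linarith

/-- The entries of `CZ + D` are bounded in terms of `Im Z` and `Im γ⟨Z⟩`: the hermitian form of
`Im γ⟨Z⟩` at the `j`-th column of `CZ + D` is the `j`-th diagonal entry of `Im Z`. -/
theorem norm_den_sq_le (γ : Sp4Z) (Z : H2) (i j : Fin 2) :
    ‖den γ Z.mat i j‖ ^ 2 ≤ (γ • Z).im.trace / (γ • Z).im.det * Z.im j j := by
  have hdet : 0 < (γ • Z).im.det := (γ • Z).2.2.det_pos
  set u : Fin 2 → ℂ := Pi.single j 1 with hu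
  have h1 := im_quadForm_action γ Z u
  rw [← smul_mul_den, ← mulVec_mulVec] at h1
  have h2 := det_mul_normSq_le (γ • Z) (den γ Z.mat *ᵥ u)
  have h3 : ∀ k, (den γ Z.mat *ᵥ u) k = den γ Z.mat k j := fun k => by
    simp [hu]
  have h4 : (star u ⬝ᵥ (Z.mat *ᵥ u)).im = Z.im j j := by
    rw [hu]
    fin_cases j <;> simp [dotProduct, Fin.sum_univ_two, H2.im]
  rw [h1, h4, h3, h3] at h2
  rw [div_mul_eq_mul_div, le_div_iff₀ hdet]
  refine le_trans ?_ h2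
  rw [mul_comm]
  gcongr
  fin_cases i
  · exact le_add_of_nonneg_right (by positivity)
  · exact le_add_of_nonneg_left (by positivity)

theorem finite_setOf_abs_le (N : ℝ) :
    {M : Matrix (Fin 2) (Fin 2) ℤ | ∀ i j, |(M i j : ℝ)| ≤ N}.Finite := by
  refine Set.Finite.subset (Set.Finite.pi' fun _ : Fin 2 => Set.Finite.pi' fun _ : Fin 2 =>
    Set.finite_Icc (-⌊N⌋) ⌊N⌋) fun M hM i j => ?_
  rw [Set.mem_Icc, ← abs_le, Int.le_floor, Int.cast_abs]
  exact hM i j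

theorem exists_forall_norm_entry_le {X E : Type*} [TopologicalSpace X] [NormedAddCommGroup E]
    {C : Set X} (hC : IsCompact C) {M : X → Matrix (Fin 2) (Fin 2) E} (hM : Continuous M) :
    ∃ b, ∀ x ∈ C, ∀ i j, ‖M x i j‖ ≤ b := by
  have : ∀ i j, ∃ b, ∀ x ∈ C, ‖M x i j‖ ≤ b := fun i j =>
    hC.exists_bound_of_continuousOn (hM.matrix_elem i j).continuousOn
  choose b hb using this
  refine ⟨∑ i, ∑ j, |b i j|, fun Z hZ i j => (hb i j Z hZ).trans ((le_abs_self _).trans ?_)⟩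
  exact (Finset.single_le_sum (f := fun j => |b i j|) (fun _ _ => abs_nonneg _)
    (Finset.mem_univ j)).trans (Finset.single_le_sum (f := fun i => ∑ j, |b i j|)
    (fun _ _ => Finset.sum_nonneg fun _ _ => abs_nonneg _) (Finset.mem_univ i))

/-- The pair `(C, D)` attached to a coset representative determines the coset. -/
theorem bottom_out_injective : Function.Injective fun q : Cosets =>
    ((q.out).1.toBlocks₂₁, (q.out).1.toBlocks₂₂) := by
  intro p q h
  rw [Prod.mk.injEq] at h
  rw [← Quotient.out_eq p, ← Quotient.out_eq q]
  exact Quotient.sound (QuotientGroup.rightRel_apply.mpr (mul_inv_mem_gammaInf_of_bottom_eq h.1 h.2))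

theorem continuous_trace_div_det : Continuous fun Y : SymPos => Y.1.trace / Y.1.det :=
  (continuous_subtype_val.matrix_trace).div continuous_subtype_val.matrix_det
    fun Y => Y.2.det_pos.ne'

/-- Only finitely many cosets `Γ_∞ γ` carry a point of a given compact subset of `ℍ₂` to a point
with imaginary part in a given compact set. -/
theorem finite_cosets {K : Set SymPos} (hK : IsCompact K) {C : Set H2} (hC : IsCompact C) :
    {q : Cosets | ∃ Z ∈ C, imPos (q.out • Z) ∈ K}.Finite := by
  obtain ⟨b₁, hb₁⟩ := hK.exists_bound_of_continuousOn continuous_trace_div_det.continuousOn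
  obtain ⟨b₂, hb₂⟩ := exists_forall_norm_entry_le hC continuous_mat
  obtain ⟨b₃, hb₃⟩ : ∃ b, ∀ Z ∈ C, ∀ i j, ‖(Z.im)⁻¹ i j‖ ≤ b := by
    refine exists_forall_norm_entry_le hC ?_
    have : (fun Z : H2 => (Z.im)⁻¹) = fun Z : H2 => (Z.im.det)⁻¹ • Z.im.adjugate := by
      funext Z
      rw [Matrix.inv_def, Ring.inverse_eq_inv]
    rw [this]
    exact (continuous_im.matrix_det.inv₀ fun Z => (show Z.im.PosDef from Z.2.2).det_pos.ne').smul
      continuous_im.matrix_adjugate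
  -- `d` bounds the entries of `CZ + D`, and `c` those of `C = Im(CZ + D) Y⁻¹`
  set d := √(b₁ * b₂) with hd
  set c := d * b₃ + d * b₃ with hc
  have main : ∀ q ∈ {q : Cosets | ∃ Z ∈ C, imPos (q.out • Z) ∈ K},
      (∀ i j, |((q.out).1.toBlocks₂₁ i j : ℝ)| ≤ c) ∧
      (∀ i j, |((q.out).1.toBlocks₂₂ i j : ℝ)| ≤ d + (c * b₂ + c * b₂)) := by
    rintro q ⟨Z, hZ, hq⟩
    generalize q.out = γ at hq
    have hden : ∀ i j, ‖den γ Z.mat i j‖ ≤ d := fun i j => by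
      refine Real.le_sqrt_of_sq_le ((norm_den_sq_le γ Z i j).trans ?_)
      have hy : 0 ≤ Z.im j j := (show Z.im.PosDef from Z.2.2).diag_pos.le
      refine mul_le_mul ((le_abs_self _).trans (hb₁ _ hq)) ?_ hy
        ((norm_nonneg _).trans (hb₁ _ hq))
      exact (le_abs_self _).trans ((Complex.abs_im_le_norm _).trans (hb₂ Z hZ j j))
    have hd0 : 0 ≤ d := Real.sqrt_nonneg _
    have hCY : (den γ Z.mat).map Complex.im =
        γ.1.toBlocks₂₁.map (Int.cast : ℤ → ℝ) * Z.im := by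
      ext i j
      simp [den, Matrix.mul_apply, H2.im]
    have hC' : γ.1.toBlocks₂₁.map (Int.cast : ℤ → ℝ) =
        (den γ Z.mat).map Complex.im * (Z.im)⁻¹ := by
      rw [hCY, Matrix.mul_assoc, mul_nonsing_inv _
        (isUnit_iff_ne_zero.mpr (show Z.im.PosDef from Z.2.2).det_pos.ne'), Matrix.mul_one]
    have hCb : ∀ i j, |(γ.1.toBlocks₂₁ i j : ℝ)| ≤ c := fun i j => by
      have e := congrFun (congrFun hC' i) j
      rw [Matrix.mul_apply, Fin.sum_univ_two] at e
      simp only [map_apply] at e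
      rw [e]
      refine (abs_add_le _ _).trans (add_le_add ?_ ?_) <;> rw [abs_mul] <;>
        exact mul_le_mul ((Complex.abs_im_le_norm _).trans (hden _ _)) (hb₃ Z hZ _ _)
          (abs_nonneg _) hd0
    refine ⟨hCb, fun i j => ?_⟩
    have e : (γ.1.toBlocks₂₂ i j : ℂ) = den γ Z.mat i j -
        ((γ.1.toBlocks₂₁ i 0 : ℂ) * Z.mat 0 j + (γ.1.toBlocks₂₁ i 1 : ℂ) * Z.mat 1 j) := by
      simp [den, Matrix.mul_apply, Fin.sum_univ_two]
    have e' : |(γ.1.toBlocks₂₂ i j : ℝ)| = ‖(γ.1.toBlocks₂₂ i j : ℂ)‖ := by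
      rw [← Complex.ofReal_intCast, Complex.norm_real, Real.norm_eq_abs]
    have hc0 : 0 ≤ c := (abs_nonneg _).trans (hCb 0 0)
    have hn : ∀ k, ‖(γ.1.toBlocks₂₁ i k : ℂ)‖ ≤ c := fun k => by
      rw [← Complex.ofReal_intCast, Complex.norm_real, Real.norm_eq_abs]
      exact hCb i k
    rw [e', e]
    refine (norm_sub_le _ _).trans (add_le_add (hden i j) ((norm_add_le _ _).trans
      (add_le_add ?_ ?_))) <;> rw [norm_mul] <;>
      exact mul_le_mul (hn _) (hb₂ Z hZ _ _) (norm_nonneg _) hc0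
  refine Set.Finite.subset (((finite_setOf_abs_le c).prod
    (finite_setOf_abs_le (d + (c * b₂ + c * b₂)))).preimage bottom_out_injective.injOn) ?_
  exact fun q hq => ⟨(main q hq).1, (main q hq).2⟩

/-! ### Logarithmic coordinates on `𝓜₂` -/

/-- The logarithmic coordinates `(log t₁, log t₂, u)` of the positive definite matrix
`Y = (1 u; 0 1) diag(t₁, t₂) (1 0; u 1)`. -/
noncomputable def logY (Y : Matrix (Fin 2) (Fin 2) ℝ) : Fin 3 → ℝ :=
  ![Real.log (Y.det / Y 1 1), Real.log (Y 1 1), Y 0 1 / Y 1 1]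

/-- The positive definite matrix with logarithmic coordinates `y`. -/
noncomputable def expMat (y : Fin 3 → ℝ) : Matrix (Fin 2) (Fin 2) ℝ :=
  !![Real.exp (y 0) + y 2 ^ 2 * Real.exp (y 1), y 2 * Real.exp (y 1);
    y 2 * Real.exp (y 1), Real.exp (y 1)]

theorem det_expMat (y : Fin 3 → ℝ) : (expMat y).det = Real.exp (y 0) * Real.exp (y 1) := by
  rw [det_fin_two]
  simp [expMat]
  ring

theorem expMat_posDef (y : Fin 3 → ℝ) : (expMat y).PosDef := by
  rw [posDef_fin_two_iff (by simp [expMat])]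
  refine ⟨by simp [expMat, Real.exp_pos], ?_⟩
  have h := det_expMat y
  rw [det_fin_two] at h
  have e : expMat y 1 0 = expMat y 0 1 := by simp [expMat]
  rw [e] at h
  rw [h]
  positivity

theorem logY_expMat (y : Fin 3 → ℝ) : logY (expMat y) = y := by
  unfold logY
  rw [det_expMat]
  have h1 := (Real.exp_pos (y 1)).ne'
  ext i
  fin_cases i <;> simp [expMat]

theorem expMat_logY {Y : Matrix (Fin 2) (Fin 2) ℝ} (hY : Y.PosDef) : expMat (logY Y) = Y := by
  have h01 : Y 1 0 = Y 0 1 := by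
    have := congrFun (congrFun hY.isHermitian 0) 1
    simpa using this
  have hd := hY.det_pos
  have h11 : 0 < Y 1 1 := hY.diag_pos
  ext i j
  fin_cases i <;> fin_cases j <;>
    simp [expMat, logY, Real.exp_log h11, Real.exp_log (div_pos hd h11), h01]
  · rw [det_fin_two, h01]
    field_simp
    ring
  · field_simp
  · field_simp

/-- The logarithmic coordinates identify the positive definite matrices with `ℝ³`. -/
noncomputable def logHomeo : SymPos ≃ₜ (Fin 3 → ℝ) where
  toFun Y := logY Y.1
  invFun y := ⟨expMat y, expMat_posDef y⟩
  left_inv Y := Subtype.ext (expMat_logY Y.2)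
  right_inv := logY_expMat
  continuous_toFun := by
    have hd : Continuous fun Y : SymPos => Y.1.det := continuous_subtype_val.matrix_det
    have he : ∀ i j, Continuous fun Y : SymPos => Y.1 i j :=
      fun i j => continuous_subtype_val.matrix_elem i j
    have h1 : ∀ Y : SymPos, Y.1 1 1 ≠ 0 := fun Y => Y.2.diag_pos.ne'
    refine continuous_pi fun i => ?_
    fin_cases i
    · exact (hd.div (he 1 1) h1).log fun Y => (div_pos Y.2.det_pos Y.2.diag_pos).ne'
    · exact (he 1 1).log h1
    · exact (he 0 1).div (he 1 1) h1
  continuous_invFun := by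
    refine Continuous.subtype_mk (continuous_matrix fun i j => ?_) _
    fin_cases i <;> fin_cases j <;> simp [expMat] <;> fun_prop

/-- The element `(1 u; 0 1) diag(√t₁, √t₂)` with `(log t₁, log t₂, u) = y`. -/
noncomputable def triExp (y : Fin 3 → ℝ) : GL(2, ℝ)⁺ :=
  triangular ⟨Real.exp (y 0), Real.exp_pos _⟩ ⟨Real.exp (y 1), Real.exp_pos _⟩ (y 2)

theorem triangular_val (t₁ t₂ : Set.Ioi (0 : ℝ)) (u : ℝ) :
    ((triangular t₁ t₂ u : GL (Fin 2) ℝ) : Matrix (Fin 2) (Fin 2) ℝ) =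
      !![√t₁.1, u * √t₂.1; 0, √t₂.1] := by
  change !![(1 : ℝ), u; 0, 1] * !![√t₁.1, 0; 0, √t₂.1] = _
  simp

theorem iota_mk (A : GL(2, ℝ)⁺) : (iotaEquiv (A : M2)).1 =
    ((A : GL (Fin 2) ℝ) : Matrix (Fin 2) (Fin 2) ℝ) *
      ((A : GL (Fin 2) ℝ) : Matrix (Fin 2) (Fin 2) ℝ)ᵀ := rfl

theorem iotaEquiv_triangular (t₁ t₂ : Set.Ioi (0 : ℝ)) (u : ℝ) :
    (iotaEquiv (triangular t₁ t₂ u : M2)).1 =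
      expMat ![Real.log t₁, Real.log t₂, u] := by
  have h1 := Real.mul_self_sqrt (le_of_lt t₁.2)
  have h2 := Real.mul_self_sqrt (le_of_lt t₂.2)
  rw [iota_mk, triangular_val]
  ext i j
  fin_cases i <;> fin_cases j <;>
    simp [expMat, Matrix.mul_apply, Fin.sum_univ_two, Real.exp_log (show 0 < t₁.1 from t₁.2),
      Real.exp_log (show 0 < t₂.1 from t₂.2), h1, h2]
  · linear_combination u ^ 2 * h2
  · linear_combination u * h2
  · linear_combination u * h2

theorem iotaEquiv_symm_apply (Y : SymPos) :
    iotaEquiv.symm Y = (triExp (logHomeo Y) : M2) := by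
  rw [Equiv.symm_apply_eq]
  apply Subtype.ext
  rw [triExp, iotaEquiv_triangular]
  have : ![Real.log (Real.exp (logHomeo Y 0)), Real.log (Real.exp (logHomeo Y 1)),
      logHomeo Y 2] = logY Y.1 := by
    ext i
    fin_cases i <;> simp [logHomeo]
  exact (expMat_logY Y.2).symm.trans (congrArg expMat this.symm)

theorem continuous_triExp : Continuous triExp := by
  have hval : Continuous fun y => ((triExp y : GL (Fin 2) ℝ) : Matrix (Fin 2) (Fin 2) ℝ) := by
    simp only [triExp, triangular_val]
    refine continuous_matrix fun i j => ?_
    fin_cases i <;> fin_cases j <;> simp <;> fun_prop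
  refine Continuous.subtype_mk (f := fun y => (triExp y : GL (Fin 2) ℝ)) ?_ _
  rw [Units.continuous_iff]
  refine ⟨hval, ?_⟩
  have : (fun y => ((triExp y : GL (Fin 2) ℝ)⁻¹ : GL (Fin 2) ℝ).val) = fun y =>
      ((triExp y : GL (Fin 2) ℝ) : Matrix (Fin 2) (Fin 2) ℝ).det⁻¹ •
      ((triExp y : GL (Fin 2) ℝ) : Matrix (Fin 2) (Fin 2) ℝ).adjugate := by
    funext y
    rw [coe_units_inv, Matrix.inv_def, Ring.inverse_eq_inv]
  rw [this]
  exact (hval.matrix_det.inv₀ fun y => ne_of_gt (triExp y).2).smul hval.matrix_adjugate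

/-- The bijection `ι` is a homeomorphism from `𝓜₂` onto the positive definite matrices. -/
noncomputable def iotaHomeo : M2 ≃ₜ SymPos where
  toEquiv := iotaEquiv
  continuous_toFun := by
    refine continuous_quot_lift _ (Continuous.subtype_mk ?_ _)
    have : Continuous fun A : GL(2, ℝ)⁺ => ((A : GL (Fin 2) ℝ) : Matrix (Fin 2) (Fin 2) ℝ) :=
      Units.continuous_val.comp continuous_subtype_val
    exact this.matrix_mul this.matrix_transpose
  continuous_invFun := by
    have : (iotaEquiv.symm : SymPos → M2) = fun Y => (triExp (logHomeo Y) : M2) :=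
      funext iotaEquiv_symm_apply
    change Continuous iotaEquiv.symm
    rw [this]
    exact continuous_quotient_mk'.comp (continuous_triExp.comp logHomeo.continuous)

/-- The logarithmic coordinates on `𝓜₂`. -/
noncomputable def logM2 : M2 ≃ₜ (Fin 3 → ℝ) := iotaHomeo.trans logHomeo

/-- The logarithmic coordinates of the imaginary part of a point of `ℍ₂`. -/
noncomputable def logIm (Z : H2) : Fin 3 → ℝ := logHomeo (imPos Z)

theorem continuous_logIm : Continuous logIm := logHomeo.continuous.comp continuous_imPos

theorem logM2_symm_imPos (Z : H2) : logM2 (iotaEquiv.symm (imPos Z)) = logIm Z := by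
  change logHomeo (iotaEquiv (iotaEquiv.symm (imPos Z))) = _
  rw [Equiv.apply_symm_apply]
  rfl

theorem hS_comp_logM2 (g : (Fin 3 → ℝ) → ℂ) (S : Lambda2) (Z : H2) :
    hS (g ∘ logM2) S Z = e (S.1 * Z.re).trace * g (logIm Z) := by
  rw [hS, Function.comp_apply, logM2_symm_imPos]

theorem logM2_mk (A : GL(2, ℝ)⁺) : logM2 (A : M2) =
    ![Real.log (((A : GL (Fin 2) ℝ) : Matrix (Fin 2) (Fin 2) ℝ).det ^ 2 /
        (entries A 1 0 ^ 2 + entries A 1 1 ^ 2)),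
      Real.log (entries A 1 0 ^ 2 + entries A 1 1 ^ 2),
      (entries A 0 0 * entries A 1 0 + entries A 0 1 * entries A 1 1) /
        (entries A 1 0 ^ 2 + entries A 1 1 ^ 2)] := by
  change logY (iotaEquiv (A : M2)).1 = _
  rw [iota_mk, logY, det_mul, det_transpose, ← sq]
  simp [Matrix.mul_apply, Fin.sum_univ_two, entries, sq]

theorem det_eq_entries (A : GL(2, ℝ)⁺) : ((A : GL (Fin 2) ℝ) : Matrix (Fin 2) (Fin 2) ℝ).det =
    entries A 0 0 * entries A 1 1 - entries A 0 1 * entries A 1 0 := by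
  rw [det_fin_two]; rfl

theorem bottom_row_pos (A : GL(2, ℝ)⁺) : 0 < entries A 1 0 ^ 2 + entries A 1 1 ^ 2 := by
  have h : 0 < ((A : GL (Fin 2) ℝ) : Matrix (Fin 2) (Fin 2) ℝ).det := A.2
  rw [det_eq_entries] at h
  by_contra hn
  have h0 : entries A 1 0 = 0 := by nlinarith [sq_nonneg (entries A 1 0), sq_nonneg (entries A 1 1)]
  have h1 : entries A 1 1 = 0 := by nlinarith [sq_nonneg (entries A 1 0), sq_nonneg (entries A 1 1)]
  rw [h0, h1] at h
  simp at h

theorem isCcSmoothM2_comp_logM2 {g : (Fin 3 → ℝ) → ℂ} (hg : ContDiff ℝ ∞ g)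
    (hc : HasCompactSupport g) : IsCcSmoothM2 (g ∘ logM2) := by
  refine ⟨?_, hc.comp_homeomorph logM2⟩
  refine ⟨fun E => g ![Real.log ((E 0 0 * E 1 1 - E 0 1 * E 1 0) ^ 2 / (E 1 0 ^ 2 + E 1 1 ^ 2)),
    Real.log (E 1 0 ^ 2 + E 1 1 ^ 2),
    (E 0 0 * E 1 0 + E 0 1 * E 1 1) / (E 1 0 ^ 2 + E 1 1 ^ 2)], ?_, ?_⟩
  · have hE : ∀ i j, ContDiffOn ℝ ∞ (fun E : Fin 2 → Fin 2 → ℝ => E i j) (Set.range entries) :=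
      fun i j => ContDiff.contDiffOn (by fun_prop)
    have hq : ContDiffOn ℝ ∞ (fun E : Fin 2 → Fin 2 → ℝ => E 1 0 ^ 2 + E 1 1 ^ 2)
        (Set.range entries) := ((hE 1 0).pow 2).add ((hE 1 1).pow 2)
    have hq0 : ∀ E ∈ Set.range entries, E 1 0 ^ 2 + E 1 1 ^ 2 ≠ 0 := by
      rintro _ ⟨A, rfl⟩
      exact (bottom_row_pos A).ne'
    refine hg.comp_contDiffOn (contDiffOn_pi.mpr fun i => ?_)
    fin_cases i
    · refine ContDiffOn.log (((((hE 0 0).mul (hE 1 1)).sub ((hE 0 1).mul (hE 1 0))).pow 2).div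
        hq hq0) ?_
      rintro _ ⟨A, rfl⟩
      rw [← det_eq_entries]
      have h : 0 < ((A : GL (Fin 2) ℝ) : Matrix (Fin 2) (Fin 2) ℝ).det := A.2
      have := bottom_row_pos A
      positivity
    · exact hq.log hq0
    · exact (((hE 0 0).mul (hE 1 0)).add ((hE 0 1).mul (hE 1 1))).div hq hq0
  · intro A
    change g (logM2 (A : M2)) = _
    rw [logM2_mk, det_eq_entries]

/-! ### Factorizable functions in logarithmic coordinates -/

/-- The homeomorphism `log` from the positive reals onto the reals. -/
noncomputable def logIoi : Set.Ioi (0 : ℝ) ≃ₜ ℝ := Real.expOrderIso.toHomeomorph.symm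

theorem logIoi_apply (t : Set.Ioi (0 : ℝ)) : logIoi t = Real.log t := by
  obtain ⟨x, rfl⟩ := logIoi.symm.surjective t
  rw [Homeomorph.apply_symm_apply]
  change x = Real.log (Real.exp x)
  rw [Real.log_exp]

theorem smoothCompact_comp_log {α : ℝ → ℂ} (h : ContDiff ℝ ∞ α) (hc : HasCompactSupport α) :
    SmoothCompact (Subtype.val : Set.Ioi (0 : ℝ) → ℝ) fun t => α (Real.log t) := by
  refine ⟨⟨fun x => α (Real.log x), ?_, fun _ => rfl⟩, ?_⟩
  · refine h.comp_contDiffOn (contDiffOn_id.log ?_)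
    rintro _ ⟨t, rfl⟩
    exact ne_of_gt t.2
  · have := hc.comp_homeomorph logIoi
    convert this using 1
    funext t
    rw [Function.comp_apply, logIoi_apply]

theorem prod_comp_logM2_mem_R2 {α : Fin 3 → ℝ → ℂ} (h : ∀ i, ContDiff ℝ ∞ (α i))
    (hc : ∀ i, HasCompactSupport (α i)) : (fun y => ∏ i, α i (y i)) ∘ logM2 ∈ R2 := by
  refine ⟨_, _, α 2, smoothCompact_comp_log (h 0) (hc 0), smoothCompact_comp_log (h 1) (hc 1),
    ⟨⟨α 2, (h 2).contDiffOn, fun _ => rfl⟩, hc 2⟩, fun t₁ t₂ u => ?_⟩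
  have : logM2 (triangular t₁ t₂ u : M2) = ![Real.log t₁, Real.log t₂, u] := by
    change logY (iotaEquiv (triangular t₁ t₂ u : M2)).1 = _
    rw [iotaEquiv_triangular, logY_expMat]
  rw [Function.comp_apply, this]
  simp [Fin.prod_univ_three]

/-- The linear change of the logarithmic coordinates to `(log Im(A·i), log det A, Re(A·i))`. -/
noncomputable def rot : (Fin 3 → ℝ) ≃ₜ (Fin 3 → ℝ) where
  toFun y := ![(y 0 - y 1) / 2, (y 0 + y 1) / 2, y 2]
  invFun w := ![w 1 + w 0, w 1 - w 0, w 2]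
  left_inv y := by
    ext i
    fin_cases i <;> simp <;> ring
  right_inv w := by
    ext i
    fin_cases i <;> simp
  continuous_toFun := by
    refine continuous_pi fun i => ?_
    fin_cases i <;> simp <;> fun_prop
  continuous_invFun := by
    refine continuous_pi fun i => ?_
    fin_cases i <;> simp <;> fun_prop

theorem contDiff_rot : ContDiff ℝ ∞ rot := by
  refine contDiff_pi.mpr fun i => ?_
  fin_cases i <;> simp [rot] <;> fun_prop

/-- The coordinates `(log Im z, Re z)` on the upper half plane. -/
noncomputable def logUHP : ℍ ≃ₜ ℝ × ℝ where
  toFun z := (Real.log z.im, z.re)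
  invFun p := ⟨⟨p.2, Real.exp p.1⟩, Real.exp_pos _⟩
  left_inv z := by
    apply UpperHalfPlane.ext
    apply Complex.ext
    · rfl
    · exact Real.exp_log z.im_pos
  right_inv p := by
    ext
    · exact Real.log_exp _
    · rfl
  continuous_toFun := (UpperHalfPlane.continuous_im.log fun z => z.im_pos.ne').prodMk
    UpperHalfPlane.continuous_re
  continuous_invFun := by
    refine Continuous.upperHalfPlaneMk (f := fun p : ℝ × ℝ => (⟨p.2, Real.exp p.1⟩ : ℂ)) ?_ _
    have : (fun p : ℝ × ℝ => (⟨p.2, Real.exp p.1⟩ : ℂ)) =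
        fun p : ℝ × ℝ => (p.2 : ℂ) + (Real.exp p.1 : ℂ) * Complex.I := by
      funext p
      exact Complex.mk_eq_add_mul_I _ _
    rw [this]
    fun_prop

theorem smul_I_eq (A : GL(2, ℝ)⁺) : (((A : GL (Fin 2) ℝ) • I : ℍ) : ℂ) =
    ⟨(entries A 0 0 * entries A 1 0 + entries A 0 1 * entries A 1 1) /
        (entries A 1 0 ^ 2 + entries A 1 1 ^ 2),
      ((A : GL (Fin 2) ℝ) : Matrix (Fin 2) (Fin 2) ℝ).det /
        (entries A 1 0 ^ 2 + entries A 1 1 ^ 2)⟩ := by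
  have hp := bottom_row_pos A
  rw [coe_smul_of_det_pos A.2, det_eq_entries]
  simp only [UpperHalfPlane.num, UpperHalfPlane.denom, UpperHalfPlane.coe_I]
  change ((entries A 0 0 : ℂ) * Complex.I + entries A 0 1) /
    ((entries A 1 0 : ℂ) * Complex.I + entries A 1 1) = _
  generalize entries A 0 0 = a, entries A 0 1 = b, entries A 1 0 = c, entries A 1 1 = d at *
  have hn : Complex.normSq ((c : ℂ) * Complex.I + d) = c ^ 2 + d ^ 2 := by
    simp [Complex.normSq_apply]
    ring
  apply Complex.ext
  · rw [Complex.div_re, hn]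
    simp
    field_simp
    ring
  · rw [Complex.div_im, hn]
    simp
    field_simp

theorem prod_rot_comp_logM2_mem_R1 {α : Fin 3 → ℝ → ℂ} (h : ∀ i, ContDiff ℝ ∞ (α i))
    (hc : ∀ i, HasCompactSupport (α i)) : (fun y => ∏ i, α i (rot y i)) ∘ logM2 ∈ R1 := by
  refine ⟨fun z => α 0 (Real.log z.im) * α 2 z.re, fun t => α 1 (Real.log t), ⟨?_, ?_⟩,
    smoothCompact_comp_log (h 1) (hc 1), fun A => ?_⟩
  · refine ⟨fun z => α 0 (Real.log z.im) * α 2 z.re, ?_, fun _ => rfl⟩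
    have him : ContDiff ℝ ∞ Complex.im := Complex.imCLM.contDiff
    have hre : ContDiff ℝ ∞ Complex.re := Complex.reCLM.contDiff
    refine ContDiffOn.mul ((h 0).comp_contDiffOn (him.contDiffOn.log ?_))
      ((h 2).comp hre).contDiffOn
    rintro _ ⟨z, rfl⟩
    exact z.im_pos.ne'
  · have : HasCompactSupport fun p : ℝ × ℝ => α 0 p.1 * α 2 p.2 := by
      refine HasCompactSupport.intro ((hc 0).isCompact.prod (hc 2).isCompact) fun p hp => ?_
      by_contra hne
      rw [mul_eq_zero, not_or] at hne
      exact hp ⟨subset_tsupport _ hne.1, subset_tsupport _ hne.2⟩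
    exact this.comp_homeomorph logUHP
  · have hq := bottom_row_pos A
    have hd : 0 < ((A : GL (Fin 2) ℝ) : Matrix (Fin 2) (Fin 2) ℝ).det := A.2
    have hre := congrArg Complex.re (smul_I_eq A)
    have him := congrArg Complex.im (smul_I_eq A)
    rw [Function.comp_apply, logM2_mk, Fin.prod_univ_three]
    simp only [UpperHalfPlane.coe_re, UpperHalfPlane.coe_im] at hre him
    dsimp only
    rw [hre, him]
    simp only [rot, Homeomorph.homeomorph_mk_coe, Equiv.coe_fn_mk, Matrix.cons_val]
    rw [Real.log_div (by positivity) hq.ne', Real.log_div hd.ne' hq.ne', Real.log_pow]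
    push_cast
    ring_nf

/-! ### Smooth functions on `ℍ₂` -/

theorem SmoothIn.continuous {f : H2 → ℂ} (hf : SmoothIn H2.coord f) : Continuous f := by
  obtain ⟨g, hg, h⟩ := hf
  rw [funext h]
  exact hg.continuousOn.comp_continuous continuous_coord fun Z => ⟨Z, rfl⟩

theorem SmoothIn.of_eventuallyEq {f : H2 → ℂ}
    (h : ∀ Z, ∃ f', SmoothIn H2.coord f' ∧ f =ᶠ[𝓝 Z] f') : SmoothIn H2.coord f := by
  refine ⟨Function.extend H2.coord f 0, ?_, fun Z => (coord_injective.extend_apply f 0 Z).symm⟩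
  rintro _ ⟨Z, rfl⟩
  obtain ⟨f', ⟨g, hg, hf'⟩, he⟩ := h Z
  have hga := hg.contDiffAt (isOpen_range_coord.mem_nhds ⟨Z, rfl⟩)
  refine (hga.congr_of_eventuallyEq ?_).contDiffWithinAt
  rw [EventuallyEq, ← isOpenEmbedding_coord.map_nhds_eq, eventually_map]
  filter_upwards [he] with W hW
  rw [coord_injective.extend_apply, hW, hf']

theorem SmoothIn.sum {X E ι : Type*} [NormedAddCommGroup E] [NormedSpace ℝ E] {c : X → E}
    {f : ι → X → ℂ} (s : Finset ι) (h : ∀ i, SmoothIn c (f i)) :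
    SmoothIn c fun x => ∑ i ∈ s, f i x := by
  choose g hg hf using h
  exact ⟨fun v => ∑ i ∈ s, g i v, ContDiffOn.sum fun i _ => hg i,
    fun x => Finset.sum_congr rfl fun i _ => hf i x⟩

theorem SmoothIn.mul {X E : Type*} [NormedAddCommGroup E] [NormedSpace ℝ E] {c : X → E}
    {f₁ f₂ : X → ℂ} (h₁ : SmoothIn c f₁) (h₂ : SmoothIn c f₂) :
    SmoothIn c fun x => f₁ x * f₂ x := by
  obtain ⟨g₁, hg₁, e₁⟩ := h₁
  obtain ⟨g₂, hg₂, e₂⟩ := h₂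
  exact ⟨fun v => g₁ v * g₂ v, hg₁.mul hg₂, fun x => congrArg₂ (· * ·) (e₁ x) (e₂ x)⟩

theorem contDiff_matrix_mul {E 𝕜 : Type*} [NormedAddCommGroup E] [NormedSpace ℝ E] [RCLike 𝕜]
    {A B : E → Matrix (Fin 2) (Fin 2) 𝕜} (hA : ∀ i j, ContDiff ℝ ∞ fun x => A x i j)
    (hB : ∀ i j, ContDiff ℝ ∞ fun x => B x i j) (i j : Fin 2) :
    ContDiff ℝ ∞ fun x => (A x * B x) i j := by
  simp only [Matrix.mul_apply]
  exact ContDiff.sum fun k _ => (hA i k).mul (hB k j)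

theorem contDiff_symMat (i j : Fin 2) : ContDiff ℝ ∞ fun c : Fin 3 → ℂ => symMat c i j := by
  fin_cases i <;> fin_cases j <;> simp [symMat] <;> fun_prop

theorem contDiff_num (γ : Sp4Z) (i j : Fin 2) :
    ContDiff ℝ ∞ fun c : Fin 3 → ℂ => SiegelPoincare.num γ (symMat c) i j := by
  simp only [SiegelPoincare.num, Matrix.add_apply]
  exact (contDiff_matrix_mul (A := fun _ => γ.1.toBlocks₁₁.map (Int.cast : ℤ → ℂ))
    (fun _ _ => contDiff_const) contDiff_symMat i j).add contDiff_const

theorem contDiff_den (γ : Sp4Z) (i j : Fin 2) :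
    ContDiff ℝ ∞ fun c : Fin 3 → ℂ => den γ (symMat c) i j := by
  simp only [den, Matrix.add_apply]
  exact (contDiff_matrix_mul (A := fun _ => γ.1.toBlocks₂₁.map (Int.cast : ℤ → ℂ))
    (fun _ _ => contDiff_const) contDiff_symMat i j).add contDiff_const

theorem contDiff_adjugate {E : Type*} [NormedAddCommGroup E] [NormedSpace ℝ E]
    {A : E → Matrix (Fin 2) (Fin 2) ℂ} (hA : ∀ i j, ContDiff ℝ ∞ fun x => A x i j) (i j : Fin 2) :
    ContDiff ℝ ∞ fun x => (A x).adjugate i j := by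
  simp only [adjugate_fin_two]
  fin_cases i <;> fin_cases j
  · exact hA 1 1
  · exact (hA 0 1).neg
  · exact (hA 1 0).neg
  · exact hA 0 0

theorem contDiffOn_inv_det_den (γ : Sp4Z) :
    ContDiffOn ℝ ∞ (fun c : Fin 3 → ℂ => ((den γ (symMat c)).det)⁻¹) (Set.range H2.coord) := by
  have hdet : ContDiff ℝ ∞ fun c : Fin 3 → ℂ => (den γ (symMat c)).det := by
    simp only [det_fin_two]
    exact ((contDiff_den γ 0 0).mul (contDiff_den γ 1 1)).sub
      ((contDiff_den γ 0 1).mul (contDiff_den γ 1 0))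
  refine hdet.contDiffOn.inv ?_
  rintro _ ⟨Z, rfl⟩
  rw [symMat_coord]
  exact (isUnit_det_den γ Z).ne_zero

/-- The entries of `(AZ + B) adj(CZ + D) / det(CZ + D)` in the coordinates of `ℍ₂`. -/
noncomputable def actionEntry (γ : Sp4Z) (i j : Fin 2) (c : Fin 3 → ℂ) : ℂ :=
  ((den γ (symMat c)).det)⁻¹ *
    (SiegelPoincare.num γ (symMat c) * (den γ (symMat c)).adjugate) i j

theorem contDiffOn_actionEntry (γ : Sp4Z) (i j : Fin 2) :
    ContDiffOn ℝ ∞ (actionEntry γ i j) (Set.range H2.coord) :=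
  (contDiffOn_inv_det_den γ).mul
    (contDiff_matrix_mul (contDiff_num γ) (contDiff_adjugate (contDiff_den γ)) i j).contDiffOn

theorem actionEntry_coord (γ : Sp4Z) (Z : H2) (i j : Fin 2) :
    actionEntry γ i j Z.coord = (γ • Z).mat i j := by
  rw [actionEntry, smul_mat, symMat_coord, Matrix.inv_def, Ring.inverse_eq_inv, Matrix.mul_smul]
  rfl

/-- The action of `γ` in the coordinates of `ℍ₂`. -/
noncomputable def coordAction (γ : Sp4Z) (c : Fin 3 → ℂ) : Fin 3 → ℂ :=
  ![actionEntry γ 0 0 c, actionEntry γ 0 1 c, actionEntry γ 1 1 c]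

theorem coordAction_coord (γ : Sp4Z) (Z : H2) : coordAction γ Z.coord = (γ • Z).coord := by
  rw [coordAction, actionEntry_coord, actionEntry_coord, actionEntry_coord]
  rfl

theorem contDiffOn_coordAction (γ : Sp4Z) :
    ContDiffOn ℝ ∞ (coordAction γ) (Set.range H2.coord) := by
  refine contDiffOn_pi.mpr fun i => ?_
  fin_cases i
  · exact contDiffOn_actionEntry γ 0 0
  · exact contDiffOn_actionEntry γ 0 1
  · exact contDiffOn_actionEntry γ 1 1

theorem SmoothIn.comp_smul {f : H2 → ℂ} (hf : SmoothIn H2.coord f) (γ : Sp4Z) :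
    SmoothIn H2.coord fun Z => f (γ • Z) := by
  obtain ⟨g, hg, h⟩ := hf
  refine ⟨g ∘ coordAction γ, hg.comp (contDiffOn_coordAction γ) ?_, fun Z => ?_⟩
  · rintro _ ⟨Z, rfl⟩
    exact ⟨γ • Z, (coordAction_coord γ Z).symm⟩
  · dsimp only [Function.comp_apply]
    rw [h, coordAction_coord]

theorem logIm_eq (Z : H2) : logIm Z =
    ![Real.log (((Z.coord 0).im * (Z.coord 2).im - (Z.coord 1).im * (Z.coord 1).im) /
        (Z.coord 2).im), Real.log (Z.coord 2).im, (Z.coord 1).im / (Z.coord 2).im] := by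
  change logY Z.im = _
  have := Z.mat_one_zero
  rw [logY, det_fin_two]
  simp [H2.im, H2.coord, this]

theorem entries_triExp (y : Fin 3 → ℝ) : entries (triExp y) =
    ![![√(Real.exp (y 0)), y 2 * √(Real.exp (y 1))], ![0, √(Real.exp (y 1))]] := by
  ext i j
  change ((triExp y : GL (Fin 2) ℝ) : Matrix (Fin 2) (Fin 2) ℝ) i j = _
  rw [triExp, triangular_val]
  fin_cases i <;> fin_cases j <;> rfl

theorem contDiff_entries_triExp : ContDiff ℝ ∞ fun y => entries (triExp y) := by
  have h : ∀ i : Fin 3, ContDiff ℝ ∞ fun y : Fin 3 → ℝ => √(Real.exp (y i)) := fun i =>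
    ContDiff.sqrt (by fun_prop) fun y => (Real.exp_pos _).ne'
  simp only [entries_triExp]
  refine contDiff_pi.mpr fun i => contDiff_pi.mpr fun j => ?_
  fin_cases i <;> fin_cases j <;> simp
  · exact h 0
  · exact (by fun_prop : ContDiff ℝ ∞ fun y : Fin 3 → ℝ => y 2).mul (h 1)
  · exact contDiff_const
  · exact h 1

theorem smoothIn_comp_iotaEquiv_symm {h : M2 → ℂ}
    (hh : SmoothIn entries fun A => h (A : M2)) :
    SmoothIn H2.coord fun Z => h (iotaEquiv.symm (imPos Z)) := by
  obtain ⟨g, hg, e⟩ := hh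
  have hi : ∀ i : Fin 3, ContDiff ℝ ∞ fun c : Fin 3 → ℂ => (c i).im := fun i =>
    Complex.imCLM.contDiff.comp (contDiff_apply ℝ ℂ i)
  have hlog : ContDiffOn ℝ ∞ (fun c : Fin 3 → ℂ =>
      ![Real.log (((c 0).im * (c 2).im - (c 1).im * (c 1).im) / (c 2).im),
        Real.log (c 2).im, (c 1).im / (c 2).im]) (Set.range H2.coord) := by
    rw [range_coord]
    have h2 : ∀ c ∈ {c : Fin 3 → ℂ | 0 < (c 2).im ∧
        0 < (c 0).im * (c 2).im - (c 1).im * (c 1).im}, (c 2).im ≠ 0 := fun c hc => hc.1.ne'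
    refine contDiffOn_pi.mpr fun i => ?_
    fin_cases i
    · exact ((((hi 0).mul (hi 2)).sub ((hi 1).mul (hi 1))).contDiffOn.div
        (hi 2).contDiffOn h2).log fun c hc => (div_pos hc.2 hc.1).ne'
    · exact (hi 2).contDiffOn.log h2
    · exact (hi 1).contDiffOn.div (hi 2).contDiffOn h2
  refine ⟨_, hg.comp (contDiff_entries_triExp.comp_contDiffOn hlog) fun c _ => ⟨_, rfl⟩,
    fun Z => ?_⟩
  simp only [Function.comp_apply]
  rw [← logIm_eq, ← e, iotaEquiv_symm_apply]
  rfl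

theorem smoothIn_hS {h : M2 → ℂ} (hh : SmoothIn entries fun A => h (A : M2)) (S : Lambda2) :
    SmoothIn H2.coord (hS h S) := by
  refine SmoothIn.mul ?_ (smoothIn_comp_iotaEquiv_symm hh)
  have hr : ∀ i j, ContDiff ℝ ∞ fun c : Fin 3 → ℂ => (symMat c i j).re := fun i j =>
    Complex.reCLM.contDiff.comp
      (by fin_cases i <;> fin_cases j <;> simp [symMat] <;> fun_prop)
  have ht : ContDiff ℝ ∞ fun c : Fin 3 → ℂ => (S.1 * (symMat c).map Complex.re).trace := by
    simp only [trace_fin_two, Matrix.mul_apply, Fin.sum_univ_two, map_apply]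
    exact ((contDiff_const.mul (hr 0 0)).add (contDiff_const.mul (hr 1 0))).add
      ((contDiff_const.mul (hr 0 1)).add (contDiff_const.mul (hr 1 1)))
  refine ⟨fun c => e (S.1 * (symMat c).map Complex.re).trace, ?_, fun Z => ?_⟩
  · unfold e
    exact ((contDiff_const.mul (Complex.ofRealCLM.contDiff.comp ht)).cexp).contDiffOn
  · dsimp only
    rw [symMat_coord]
    rfl

/-! ### The Poincaré series as smooth functions of compact support -/

theorem imPos_smul_of_mem {n : Sp4Z} (hn : n ∈ GammaInf) (Z : H2) :
    imPos (n • Z) = imPos Z := by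
  obtain ⟨X, -, hn⟩ := hn
  apply Subtype.ext
  ext i j
  simp [imPos, H2.im, smul_mat_of_mem n X hn Z]

theorem out_mul_inv_mem (γ : Sp4Z) :
    γ * (Quotient.out (Quotient.mk _ γ : Cosets))⁻¹ ∈ GammaInf := by
  have : (Quotient.mk _ (Quotient.out (Quotient.mk _ γ : Cosets)) : Cosets) = Quotient.mk _ γ :=
    Quotient.out_eq _
  exact QuotientGroup.rightRel_apply.mp (Quotient.exact this)

theorem imPos_out_smul (γ : Sp4Z) (Z : H2) :
    imPos ((Quotient.mk _ γ : Cosets).out • Z) = imPos (γ • Z) := by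
  have := imPos_smul_of_mem (out_mul_inv_mem γ) ((Quotient.mk _ γ : Cosets).out • Z)
  rw [← mul_smul, inv_mul_cancel_right] at this
  exact this.symm

theorem poincareTerm_eq (h : M2 → ℂ) (S : Lambda2) (Z : H2) (q : Cosets) :
    poincareTerm h S Z q = hS h S (q.out • Z) := by
  conv_lhs => rw [← Quotient.out_eq q]
  rfl

theorem imPos_mem_of_hS_ne_zero {h : M2 → ℂ} {S : Lambda2} {Z : H2} (hZ : hS h S Z ≠ 0) :
    imPos Z ∈ iotaHomeo '' tsupport h := by
  refine ⟨iotaEquiv.symm (imPos Z), subset_tsupport _ (right_ne_zero_of_mul hZ), ?_⟩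
  exact iotaEquiv.apply_symm_apply _

theorem isCompact_image_tsupport {h : M2 → ℂ} (hh : HasCompactSupport h) :
    IsCompact (iotaHomeo '' tsupport h) :=
  hh.isCompact.image iotaHomeo.continuous

theorem support_poincareTerm_finite {h : M2 → ℂ} (hh : HasCompactSupport h) (S : Lambda2)
    (Z : H2) : (Function.support (poincareTerm h S Z)).Finite := by
  refine (finite_cosets (isCompact_image_tsupport hh) (isCompact_singleton (x := Z))).subset
    fun q hq => ⟨Z, rfl, ?_⟩
  rw [Function.mem_support, poincareTerm_eq] at hq
  exact imPos_mem_of_hS_ne_zero hq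

theorem smoothIn_poincareH2 {h : M2 → ℂ} (hh : IsCcSmoothM2 h) (S : Lambda2) :
    SmoothIn H2.coord (poincareH2 h S) := by
  refine SmoothIn.of_eventuallyEq fun Z => ?_
  obtain ⟨C, hC, hZ⟩ := exists_compact_mem_nhds Z
  have hfin := finite_cosets (isCompact_image_tsupport hh.2) hC
  refine ⟨fun W => ∑ q ∈ hfin.toFinset, hS h S (q.out • W),
    SmoothIn.sum _ fun q => (smoothIn_hS hh.1 S).comp_smul _, ?_⟩
  filter_upwards [hZ] with W hW
  rw [poincareH2, finsum_eq_sum_of_support_subset (s := hfin.toFinset)]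
  · exact Finset.sum_congr rfl fun q _ => poincareTerm_eq h S W q
  · intro q hq
    rw [Function.mem_support, poincareTerm_eq] at hq
    rw [Set.Finite.coe_toFinset]
    exact ⟨W, hW, imPos_mem_of_hS_ne_zero hq⟩

/-- The point `X + iY` of `ℍ₂`. -/
noncomputable def pointXY (x : Fin 3 → ℝ) (Y : SymPos) : H2 :=
  ⟨(symMat x).map Complex.ofReal + Complex.I • Y.1.map Complex.ofReal, by
    have hY : Y.1 1 0 = Y.1 0 1 := by
      have := congrFun (congrFun Y.2.isHermitian 0) 1
      simpa using this
    ext i j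
    fin_cases i <;> fin_cases j <;> simp [symMat, hY], by
    have : ((symMat x).map Complex.ofReal + Complex.I • Y.1.map Complex.ofReal).map Complex.im =
        Y.1 := by
      ext i j
      simp
    rw [this]
    exact Y.2⟩

theorem imPos_pointXY (x : Fin 3 → ℝ) (Y : SymPos) : imPos (pointXY x Y) = Y := by
  apply Subtype.ext
  ext i j
  simp [imPos, H2.im, pointXY, H2.mat]

/-- The real parts of the coordinates of a point of `ℍ₂`. -/
def reCoord (Z : H2) : Fin 3 → ℝ := fun i => (Z.coord i).re

theorem symMat_reCoord (Z : H2) : symMat (reCoord Z) = Z.re := by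
  rw [H2.re, ← symMat_coord]
  ext i j
  fin_cases i <;> fin_cases j <;> rfl

theorem pointXY_reCoord (Z : H2) : pointXY (reCoord Z) (imPos Z) = Z := by
  apply H2.ext
  change (symMat (reCoord Z)).map Complex.ofReal + Complex.I • (imPos Z).1.map Complex.ofReal = _
  rw [symMat_reCoord]
  ext i j
  simp [H2.re, imPos, H2.im, mul_comm Complex.I]

theorem continuous_pointXY : Continuous fun p : (Fin 3 → ℝ) × SymPos => pointXY p.1 p.2 := by
  have hx : Continuous fun p : (Fin 3 → ℝ) × SymPos => symMat p.1 := by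
    refine continuous_matrix fun i j => ?_
    fin_cases i <;> fin_cases j <;> simp [symMat] <;> fun_prop
  have hY : Continuous fun p : (Fin 3 → ℝ) × SymPos => p.2.1 :=
    continuous_subtype_val.comp continuous_snd
  exact Continuous.subtype_mk ((hx.matrix_map Complex.continuous_ofReal).add
    ((hY.matrix_map Complex.continuous_ofReal).const_smul Complex.I)) _

/-- The integral translation `n(X)`, with `X` given by its coordinates. -/
def transl (n : Fin 3 → ℤ) : Sp4Z :=
  ⟨nMat (symMat n), by
    rw [nMat, SymplecticGroup.fromBlocks_mem_iff]
    refine ⟨by simp, ?_, by simp⟩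
    ext i j
    fin_cases i <;> fin_cases j <;> simp [symMat]⟩

theorem transl_mem (n : Fin 3 → ℤ) : transl n ∈ GammaInf :=
  ⟨symMat n, by ext i j; fin_cases i <;> fin_cases j <;> simp [symMat], rfl⟩

theorem transl_smul_pointXY (n : Fin 3 → ℤ) (x : Fin 3 → ℝ) (Y : SymPos) :
    transl n • pointXY x Y = pointXY (fun i => x i + n i) Y := by
  apply H2.ext
  rw [smul_mat_of_mem _ _ rfl]
  change (symMat x).map Complex.ofReal + Complex.I • Y.1.map Complex.ofReal + _ =
    (symMat _).map Complex.ofReal + Complex.I • Y.1.map Complex.ofReal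
  ext i j
  fin_cases i <;> fin_cases j <;> simp [symMat] <;> ring

/-- The set of points of `Γ \ ℍ₂` having a representative with imaginary part in `K`. -/
def tube (K : Set SymPos) : Set Quot2 := proj '' (imPos ⁻¹' K)

theorem isCompact_tube {K : Set SymPos} (hK : IsCompact K) : IsCompact (tube K) := by
  have hB : IsCompact (Set.Icc (0 : Fin 3 → ℝ) 1) := isCompact_Icc
  have := ((hB.prod hK).image continuous_pointXY).image continuous_proj
  convert this using 1
  apply Set.Subset.antisymm
  · rintro _ ⟨Z, hZ, rfl⟩
    set n : Fin 3 → ℤ := fun i => -⌊reCoord Z i⌋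
    refine ⟨transl n • Z, ⟨(fun i => reCoord Z i + n i, imPos Z), ⟨⟨fun i => ?_, fun i => ?_⟩, hZ⟩,
      ?_⟩, proj_smul _ _⟩
    · have := Int.floor_le (reCoord Z i)
      simp [n, this]
    · have := (Int.lt_floor_add_one (reCoord Z i)).le
      simp [n]
      linarith
    · dsimp only
      rw [← transl_smul_pointXY, pointXY_reCoord]
  · rintro _ ⟨_, ⟨p, hp, rfl⟩, rfl⟩
    exact ⟨_, by rw [Set.mem_preimage, imPos_pointXY]; exact hp.2, rfl⟩

/-- Closedness is proved from the local finiteness of the translates of the tube upstairs, without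
appeal to a separation property of `Γ \ ℍ₂`. -/
theorem isClosed_tube {K : Set SymPos} (hK : IsCompact K) : IsClosed (tube K) := by
  have hq : IsQuotientMap proj := isQuotientMap_quotient_mk'
  rw [← hq.isClosed_preimage]
  have : proj ⁻¹' tube K = ⋃ q : Cosets, {Z | imPos (q.out • Z) ∈ K} := by
    ext Z
    rw [Set.mem_iUnion]
    constructor
    · rintro ⟨W, hW, h⟩
      obtain ⟨γ, rfl⟩ := proj_eq_iff.mp h
      refine ⟨Quotient.mk _ γ, ?_⟩
      change imPos _ ∈ K
      rw [imPos_out_smul]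
      exact hW
    · rintro ⟨q, hq⟩
      exact ⟨q.out • Z, hq, proj_smul _ _⟩
  rw [this]
  refine LocallyFinite.isClosed_iUnion (fun Z => ?_) fun q =>
    hK.isClosed.preimage (continuous_imPos.comp (continuous_smul _))
  obtain ⟨C, hC, hZ⟩ := exists_compact_mem_nhds Z
  refine ⟨C, hZ, (finite_cosets hK hC).subset ?_⟩
  rintro q ⟨W, hW, hW'⟩
  exact ⟨W, hW', hW⟩

theorem hasCompactSupport_of_tube {K : Set SymPos} (hK : IsCompact K) {φ : Quot2 → ℂ}
    (h : ∀ q ∉ tube K, φ q = 0) : HasCompactSupport φ := by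
  refine (isCompact_tube hK).of_isClosed_subset isClosed_closure
    (closure_minimal (fun q hq => ?_) (isClosed_tube hK))
  by_contra hn
  exact hq (h q hn)

theorem isCcSmoothQuot_poincare {h : M2 → ℂ} (hh : IsCcSmoothM2 h) (S : Lambda2) :
    IsCcSmoothQuot (poincare h S) := by
  refine ⟨smoothIn_poincareH2 hh S,
    hasCompactSupport_of_tube (isCompact_image_tsupport hh.2) fun q hq => ?_⟩
  obtain ⟨Z, rfl⟩ := proj_surjective q
  refine finsum_eq_zero_of_forall_eq_zero fun q => ?_
  by_contra hne
  rw [poincareTerm_eq] at hne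
  exact hq ⟨q.out • Z, imPos_mem_of_hS_ne_zero hne, proj_smul _ _⟩

/-! ### Smooth partitions of unity on `ℝ³` -/

/-- A smooth cut-off function on `ℝ`, equal to `1` on `[-M, M]` and to `0` outside
`[-M - 1, M + 1]`. -/
noncomputable def cut (M x : ℝ) : ℝ :=
  Real.smoothTransition (x + M + 1) - Real.smoothTransition (x - M)

theorem contDiff_cut (M : ℝ) : ContDiff ℝ ∞ (cut M) := by
  unfold cut
  exact (Real.smoothTransition.contDiff.comp (by fun_prop)).sub
    (Real.smoothTransition.contDiff.comp (by fun_prop))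

theorem cut_nonneg {M : ℝ} (hM : 0 ≤ M) (x : ℝ) : 0 ≤ cut M x :=
  sub_nonneg.mpr (Real.smoothTransition.monotone (by linarith))

theorem cut_le_one (M x : ℝ) : cut M x ≤ 1 := by
  have h1 := Real.smoothTransition.le_one (x + M + 1)
  have h2 := Real.smoothTransition.nonneg (x - M)
  unfold cut
  linarith

theorem cut_eq_one {M x : ℝ} (hx : |x| ≤ M) : cut M x = 1 := by
  obtain ⟨h1, h2⟩ := abs_le.mp hx
  rw [cut, Real.smoothTransition.one_of_one_le (by linarith),
    Real.smoothTransition.zero_of_nonpos (by linarith), sub_zero]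

theorem abs_lt_of_cut_ne_zero {M x : ℝ} (hM : 0 ≤ M) (hx : cut M x ≠ 0) : |x| < M + 1 := by
  by_contra! h
  apply hx
  rcases le_abs.mp h with h | h
  · rw [cut, Real.smoothTransition.one_of_one_le (by linarith),
      Real.smoothTransition.one_of_one_le (by linarith), sub_self]
  · rw [cut, Real.smoothTransition.zero_of_nonpos (by linarith),
      Real.smoothTransition.zero_of_nonpos (by linarith), sub_self]

/-- The integral translates of `cut 0` form a partition of unity. -/
theorem sum_cut (N : ℕ) (x : ℝ) :
    ∑ n ∈ Finset.Icc (-N : ℤ) N, cut 0 (x - n) = cut N x := by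
  induction N with
  | zero => simp
  | succ N ih =>
    have h : Finset.Icc (-((N + 1 : ℕ) : ℤ)) ((N + 1 : ℕ) : ℤ) =
        insert (-((N + 1 : ℕ) : ℤ)) (insert ((N + 1 : ℕ) : ℤ) (Finset.Icc (-N : ℤ) N)) := by
      ext k
      simp only [Finset.mem_Icc, Finset.mem_insert]
      omega
    rw [h, Finset.sum_insert, Finset.sum_insert, ih]
    · simp only [cut]
      push_cast
      ring_nf
    · simp
    · simp only [Finset.mem_insert, Finset.mem_Icc]
      omega

theorem HasCompactSupport.of_norm_le {E F : Type*} [NormedAddCommGroup E] [ProperSpace E]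
    [Zero F] {f : E → F} {M : ℝ} (h : ∀ y, f y ≠ 0 → ‖y‖ ≤ M) : HasCompactSupport f :=
  HasCompactSupport.intro (isCompact_closedBall 0 M) fun y hy => by
    by_contra hne
    exact hy (mem_closedBall_zero_iff.mpr (h y hne))

/-- A compactly supported continuous function on `ℝ³` is uniformly approximated by finite sums of
vectors weighted by products of smooth bumps in the three variables. -/
theorem exists_sum_prod_smul_approx {E : Type*} [NormedAddCommGroup E] [NormedSpace ℝ E]
    {f : (Fin 3 → ℝ) → E} (hf : Continuous f) {M : ℝ} (hM0 : 0 ≤ M)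
    (hM : ∀ y, f y ≠ 0 → ‖y‖ ≤ M) {ε : ℝ} (hε : 0 < ε) :
    ∃ (s : Finset (Fin 3 → ℤ)) (w : (Fin 3 → ℤ) → Fin 3 → ℝ → ℝ) (v : (Fin 3 → ℤ) → E),
      (∀ k i, ContDiff ℝ ∞ (w k i)) ∧ (∀ k i x, 0 ≤ w k i x) ∧
      (∀ k ∈ s, ∀ i x, w k i x ≠ 0 → |x| ≤ M + 3) ∧
      (∀ y : Fin 3 → ℝ, ∑ k ∈ s, ∏ i, w k i (y i) ≤ 1) ∧
      ∀ y, ‖f y - ∑ k ∈ s, (∏ i, w k i (y i)) • v k‖ ≤ ε := by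
  have hu := (HasCompactSupport.of_norm_le hM).uniformContinuous_of_continuous hf
  obtain ⟨δ, hδ, hd⟩ := Metric.uniformContinuous_iff.mp hu ε hε
  -- a grid of mesh `1 / L ≤ δ`, with enough nodes to cover the support of `f`; the condition
  -- `1 ≤ L` keeps the bumps at the outermost nodes within the box of radius `M + 3`
  set L := max 1 (1 / δ) with hL
  have hL1 : 1 ≤ L := le_max_left _ _
  have hLδ : 1 / L ≤ δ := by
    rw [div_le_iff₀ (by linarith), mul_comm, ← div_le_iff₀ hδ]
    exact le_max_right _ _
  set N := ⌈L * (M + 1)⌉₊ with hN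
  have hN1 : L * (M + 1) ≤ N := Nat.le_ceil _
  have hN2 : (N : ℝ) < L * (M + 1) + 1 := Nat.ceil_lt_add_one (by positivity)
  set w : (Fin 3 → ℤ) → Fin 3 → ℝ → ℝ := fun k i x => cut 0 (L * x - k i) with hw
  set s : Finset (Fin 3 → ℤ) := Fintype.piFinset fun _ => Finset.Icc (-N : ℤ) N with hs
  have hw0 : ∀ k i x, 0 ≤ w k i x := fun k i x => cut_nonneg le_rfl _
  have hsum : ∀ y : Fin 3 → ℝ, ∑ k ∈ s, ∏ i, w k i (y i) = ∏ i, cut N (L * y i) := fun y => by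
    simp only [hw, hs, ← sum_cut]
    exact (Finset.prod_univ_sum (fun _ => Finset.Icc (-N : ℤ) N)
      (fun i n => cut 0 (L * y i - n))).symm
  have hle : ∀ y : Fin 3 → ℝ, ∑ k ∈ s, ∏ i, w k i (y i) ≤ 1 := fun y => by
    rw [hsum]
    exact Finset.prod_le_one (fun i _ => cut_nonneg (Nat.cast_nonneg _) _)
      fun i _ => cut_le_one _ _
  refine ⟨s, w, fun k => f fun i => k i / L, fun k i => (contDiff_cut 0).comp (by fun_prop), hw0,
    fun k hk i x hx => ?_, hle, fun y => ?_⟩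
  · have h1 := abs_lt_of_cut_ne_zero le_rfl hx
    have h2 : |(k i : ℝ)| ≤ N := by
      have := Finset.mem_Icc.mp (Fintype.mem_piFinset.mp hk i)
      rw [abs_le]
      exact_mod_cast this
    have h3 : |L * x| ≤ L * (M + 3) := by
      have : |L * x| ≤ |L * x - k i| + |(k i : ℝ)| := by
        simpa using abs_add_le (L * x - k i) (k i)
      nlinarith
    rw [abs_mul, abs_of_pos (by linarith)] at h3
    exact le_of_mul_le_mul_left h3 (by linarith)
  · -- the weights add up to `1` wherever `f` does not vanish
    have h1 : f y = ∑ k ∈ s, (∏ i, w k i (y i)) • f y := by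
      rw [← Finset.sum_smul, hsum]
      by_cases h0 : f y = 0
      · simp [h0]
      · rw [Finset.prod_eq_one, one_smul]
        intro i _
        apply cut_eq_one
        rw [abs_mul, abs_of_pos (by linarith)]
        have := (norm_le_pi_norm y i).trans (hM y h0)
        rw [Real.norm_eq_abs] at this
        nlinarith
    conv_lhs => rw [h1]
    rw [← Finset.sum_sub_distrib]
    refine (norm_sum_le _ _).trans ?_
    calc ∑ k ∈ s, ‖(∏ i, w k i (y i)) • f y - (∏ i, w k i (y i)) • f fun i => k i / L‖
        ≤ ∑ k ∈ s, (∏ i, w k i (y i)) * ε := by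
          refine Finset.sum_le_sum fun k _ => ?_
          have hp : 0 ≤ ∏ i, w k i (y i) := Finset.prod_nonneg fun i _ => hw0 k i _
          rw [← smul_sub, norm_smul, Real.norm_of_nonneg hp]
          by_cases h0 : ∏ i, w k i (y i) = 0
          · simp [h0]
          · refine mul_le_mul_of_nonneg_left ?_ hp
            rw [← dist_eq_norm]
            refine (hd ?_).le
            rw [dist_pi_lt_iff hδ]
            intro i
            have h2 := abs_lt_of_cut_ne_zero le_rfl (Finset.prod_ne_zero_iff.mp h0 i
              (Finset.mem_univ i))
            rw [Real.dist_eq]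
            refine lt_of_lt_of_le ?_ hLδ
            rw [lt_div_iff₀ (by linarith), ← abs_of_pos (show 0 < L by linarith), ← abs_mul,
              abs_of_pos (show 0 < L by linarith), sub_mul, div_mul_cancel₀ _ (by linarith),
              mul_comm]
            linarith
      _ = (∑ k ∈ s, ∏ i, w k i (y i)) * ε := by rw [Finset.sum_mul]
      _ ≤ 1 * ε := mul_le_mul_of_nonneg_right (hle y) hε.le
      _ = ε := one_mul _

/-! ### Approximation of periodic functions by factorizable data -/

theorem norm_rot_le (y : Fin 3 → ℝ) : ‖rot y‖ ≤ ‖y‖ := by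
  have h : ∀ i, |y i| ≤ ‖y‖ := fun i => norm_le_pi_norm y i
  rw [pi_norm_le_iff_of_nonneg (norm_nonneg _)]
  have h0 := abs_le.mp (h 0)
  have h1 := abs_le.mp (h 1)
  intro i
  rw [Real.norm_eq_abs]
  fin_cases i
  · change |(y 0 - y 1) / 2| ≤ _
    rw [abs_le]
    constructor <;> linarith
  · change |(y 0 + y 1) / 2| ≤ _
    rw [abs_le]
    constructor <;> linarith
  · exact h 2

theorem norm_le_two_mul_norm_rot (y : Fin 3 → ℝ) : ‖y‖ ≤ 2 * ‖rot y‖ := by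
  have h : ∀ i, |rot y i| ≤ ‖rot y‖ := fun i => norm_le_pi_norm (rot y) i
  have h0 : |(y 0 - y 1) / 2| ≤ ‖rot y‖ := h 0
  have h1 : |(y 0 + y 1) / 2| ≤ ‖rot y‖ := h 1
  have h2 : |y 2| ≤ ‖rot y‖ := h 2
  rw [pi_norm_le_iff_of_nonneg (by positivity)]
  rw [abs_le] at h0 h1
  intro i
  rw [Real.norm_eq_abs]
  fin_cases i
  · change |y 0| ≤ _
    rw [abs_le]
    constructor <;> linarith
  · change |y 1| ≤ _
    rw [abs_le]
    constructor <;> linarith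
  · change |y 2| ≤ _
    linarith [norm_nonneg (rot y)]

/-- For each of the two families there are coordinates on `𝓜₂` in which products of functions of
one variable belong to the family. -/
theorem exists_product_coordinates (j : Fin 2) : ∃ T : (Fin 3 → ℝ) ≃ₜ (Fin 3 → ℝ),
    ContDiff ℝ ∞ T ∧ (∀ y, ‖T y‖ ≤ ‖y‖) ∧ (∀ y, ‖y‖ ≤ 2 * ‖T y‖) ∧
    ∀ α : Fin 3 → ℝ → ℂ, (∀ i, ContDiff ℝ ∞ (α i)) → (∀ i, HasCompactSupport (α i)) →
      (fun y => ∏ i, α i (T y i)) ∘ logM2 ∈ (![R1, R2] : Fin 2 → Set (M2 → ℂ)) j := by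
  fin_cases j
  · exact ⟨rot, contDiff_rot, norm_rot_le, norm_le_two_mul_norm_rot,
      fun α h hc => prod_rot_comp_logM2_mem_R1 h hc⟩
  · exact ⟨Homeomorph.refl _, contDiff_id, fun y => le_rfl,
      fun y => by change ‖y‖ ≤ 2 * ‖y‖; linarith [norm_nonneg y],
      fun α h hc => prod_comp_logM2_mem_R2 h hc⟩

/-- The summands `h_S` with `h` in the family selected by `r`, smooth, and supported in the ball of
radius `M` of the logarithmic coordinates. -/
def gens (r : Lambda2 → Fin 2) (M : ℝ) : Set (H2 → ℂ) :=
  {Ψ | ∃ (S : Lambda2) (h : M2 → ℂ), h ∈ (![R1, R2] : Fin 2 → Set (M2 → ℂ)) (r S) ∧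
    IsCcSmoothM2 h ∧ (∀ m, h m ≠ 0 → ‖logM2 m‖ ≤ M) ∧ Ψ = hS h S}

/-- The uniform closure of the linear span of `gens r M`. -/
def approxSpan (r : Lambda2 → Fin 2) (M : ℝ) : Submodule ℂ (H2 → ℂ) where
  carrier := {Φ | ∀ ε : ℝ, 0 < ε → ∃ Ψ ∈ Submodule.span ℂ (gens r M), ∀ Z, ‖Φ Z - Ψ Z‖ ≤ ε}
  zero_mem' ε hε := ⟨0, zero_mem _, fun Z => by simp [hε.le]⟩
  add_mem' {Φ₁ Φ₂} h₁ h₂ ε hε := by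
    obtain ⟨Ψ₁, m₁, e₁⟩ := h₁ (ε / 2) (half_pos hε)
    obtain ⟨Ψ₂, m₂, e₂⟩ := h₂ (ε / 2) (half_pos hε)
    refine ⟨Ψ₁ + Ψ₂, add_mem m₁ m₂, fun Z => ?_⟩
    rw [Pi.add_apply, Pi.add_apply, add_sub_add_comm]
    exact (norm_add_le _ _).trans (by linarith [e₁ Z, e₂ Z])
  smul_mem' c Φ h ε hε := by
    obtain ⟨Ψ, m, hΨ⟩ := h (ε / (‖c‖ + 1)) (by positivity)
    refine ⟨c • Ψ, Submodule.smul_mem _ c m, fun Z => ?_⟩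
    rw [Pi.smul_apply, Pi.smul_apply, ← smul_sub, norm_smul]
    have h1 := hΨ Z
    rw [le_div_iff₀ (by positivity)] at h1
    nlinarith [norm_nonneg (Φ Z - Ψ Z)]

theorem norm_e (x : ℝ) : ‖e x‖ = 1 := by
  rw [e, show (2 * Real.pi * Complex.I * x : ℂ) = ((2 * Real.pi * x : ℝ) : ℂ) * Complex.I by
    push_cast; ring]
  exact Complex.norm_exp_ofReal_mul_I _

/-- With `S` fixed, approximate the function of `Y` by sums of products in the coordinates adapted
to the family `r S`. The doubling of the radius comes from the change to these coordinates. -/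
theorem hS_mem_approxSpan (r : Lambda2 → Fin 2) {M : ℝ} (hM0 : 0 ≤ M) {g : (Fin 3 → ℝ) → ℂ}
    (hg : Continuous g) (hM : ∀ y, g y ≠ 0 → ‖y‖ ≤ M) (S : Lambda2) :
    hS (g ∘ logM2) S ∈ approxSpan r (2 * (M + 3)) := by
  intro ε hε
  obtain ⟨T, hT, hT1, hT2, hmem⟩ := exists_product_coordinates (r S)
  obtain ⟨s, w, v, hw, -, hws, -, hwv⟩ := exists_sum_prod_smul_approx
    (f := g ∘ T.symm) (hg.comp T.symm.continuous) hM0 (fun y hy => by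
      have := (hT1 (T.symm y)).trans (hM _ hy)
      rwa [T.apply_symm_apply] at this) hε
  set W : (Fin 3 → ℤ) → (Fin 3 → ℝ) → ℂ := fun k y => ∏ i, (w k i (T y i) : ℂ) with hW
  refine ⟨∑ k ∈ s, v k • hS (W k ∘ logM2) S, Submodule.sum_mem _ fun k hk =>
    Submodule.smul_mem _ _ (Submodule.subset_span ⟨S, _, ?_, ?_, ?_, rfl⟩), fun Z => ?_⟩
  · refine hmem (fun i x => (w k i x : ℂ)) (fun i => Complex.ofRealCLM.contDiff.comp (hw k i))
      fun i => HasCompactSupport.of_norm_le (M := M + 3) fun x hx => hws k hk i x ?_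
    exact_mod_cast hx
  · refine isCcSmoothM2_comp_logM2 ?_ (HasCompactSupport.of_norm_le (M := 2 * (M + 3)) ?_)
    · exact contDiff_prod fun i _ => Complex.ofRealCLM.contDiff.comp
        ((hw k i).comp ((contDiff_apply ℝ ℝ i).comp hT))
    · intro y hy
      refine (hT2 y).trans (mul_le_mul_of_nonneg_left ?_ zero_le_two)
      refine (pi_norm_le_iff_of_nonneg (by linarith)).mpr fun i => hws k hk i _ ?_
      exact_mod_cast Finset.prod_ne_zero_iff.mp hy i (Finset.mem_univ i)
  · intro m hm
    refine (hT2 _).trans (mul_le_mul_of_nonneg_left ?_ zero_le_two)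
    refine (pi_norm_le_iff_of_nonneg (by linarith)).mpr fun i => hws k hk i _ ?_
    exact_mod_cast Finset.prod_ne_zero_iff.mp hm i (Finset.mem_univ i)
  · have h1 := hwv (T (logIm Z))
    rw [Function.comp_apply, T.symm_apply_apply] at h1
    have h2 : hS (g ∘ logM2) S Z - (∑ k ∈ s, v k • hS (W k ∘ logM2) S) Z =
        e (S.1 * Z.re).trace * (g (logIm Z) -
          ∑ k ∈ s, (∏ i, w k i (T (logIm Z) i)) • v k) := by
      rw [hS_comp_logM2, Finset.sum_apply, mul_sub, Finset.mul_sum]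
      congr 1
      refine Finset.sum_congr rfl fun k _ => ?_
      rw [Pi.smul_apply, hS_comp_logM2, smul_eq_mul, Complex.real_smul]
      simp only [hW]
      push_cast
      ring
    rw [h2, norm_mul, norm_e, one_mul]
    exact h1

/-- The class of the real part of `Z` in the torus `M₂^Sym(ℝ) / M₂^Sym(ℤ)`. -/
noncomputable def torusRe (Z : H2) : UnitAddTorus (Fin 3) := fun i => (reCoord Z i : UnitAddCircle)

/-- The semi-integral matrix with coefficients `n = (m, r, k)`. -/
noncomputable def freq (n : Fin 3 → ℤ) : Lambda2 :=
  ⟨!![(n 0 : ℝ), (n 1 : ℝ) / 2; (n 1 : ℝ) / 2, (n 2 : ℝ)], n 0, n 1, n 2, rfl⟩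

theorem mFourier_torusRe (n : Fin 3 → ℤ) (Z : H2) :
    UnitAddTorus.mFourier n (torusRe Z) = e ((freq n).1 * Z.re).trace := by
  have ht : ((freq n).1 * Z.re).trace =
      n 0 * reCoord Z 0 + n 1 * reCoord Z 1 + n 2 * reCoord Z 2 := by
    rw [← symMat_reCoord]
    simp [freq, trace_fin_two, symMat]
    ring
  rw [ht]
  simp only [UnitAddTorus.mFourier, ContinuousMap.coe_mk, Fin.prod_univ_three, torusRe]
  rw [fourier_coe_apply, fourier_coe_apply, fourier_coe_apply, ← Complex.exp_add,
    ← Complex.exp_add, e]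
  congr 1
  push_cast
  ring

theorem mul_torusRe_mem_approxSpan (r : Lambda2 → Fin 2) {M : ℝ} (hM0 : 0 ≤ M)
    {g : (Fin 3 → ℝ) → ℂ} (hg : Continuous g) (hM : ∀ y, g y ≠ 0 → ‖y‖ ≤ M)
    {p : C(UnitAddTorus (Fin 3), ℂ)}
    (hp : p ∈ Submodule.span ℂ (Set.range (UnitAddTorus.mFourier (d := Fin 3)))) :
    (fun Z => p (torusRe Z) * g (logIm Z)) ∈ approxSpan r (2 * (M + 3)) := by
  induction hp using Submodule.span_induction with
  | mem p hp =>
    obtain ⟨n, rfl⟩ := hp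
    convert hS_mem_approxSpan r hM0 hg hM (freq n) using 1
    funext Z
    rw [hS_comp_logM2, mFourier_torusRe]
  | zero =>
    convert zero_mem (approxSpan r (2 * (M + 3))) using 1
    funext Z
    simp
  | add p q _ _ hp hq =>
    convert add_mem hp hq using 1
    funext Z
    simp [add_mul]
  | smul c p _ hp =>
    convert Submodule.smul_mem _ c hp using 1
    funext Z
    simp [mul_assoc]

/-- The reduction `ℝ³ → (ℝ/ℤ)³` in the second factor. -/
noncomputable def reduceSnd (p : (Fin 3 → ℝ) × (Fin 3 → ℝ)) :
    (Fin 3 → ℝ) × UnitAddTorus (Fin 3) := (p.1, fun i => (p.2 i : UnitAddCircle))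

theorem isOpenQuotientMap_reduceSnd : IsOpenQuotientMap reduceSnd :=
  IsOpenQuotientMap.id.prodMap (IsOpenQuotientMap.piMap fun _ =>
    QuotientAddGroup.isOpenQuotientMap_mk)

/-- A `Γ_∞`-invariant continuous function is a continuous function of the logarithmic coordinates
of `Y` and of the class of `X` in the torus. -/
theorem exists_torus_lift {G : H2 → ℂ} (hG : Continuous G)
    (hinv : ∀ n ∈ GammaInf, ∀ Z, G (n • Z) = G Z) :
    ∃ f : C((Fin 3 → ℝ) × UnitAddTorus (Fin 3), ℂ), ∀ x y,
      f (reduceSnd (y, x)) = G (pointXY x (logHomeo.symm y)) := by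
  set G₀ : (Fin 3 → ℝ) × (Fin 3 → ℝ) → ℂ := fun p => G (pointXY p.2 (logHomeo.symm p.1)) with hG₀
  have hcont : Continuous G₀ := hG.comp (continuous_pointXY.comp
    (continuous_snd.prodMk (logHomeo.symm.continuous.comp continuous_fst)))
  set f : (Fin 3 → ℝ) × UnitAddTorus (Fin 3) → ℂ :=
    fun q => G₀ (Function.surjInv isOpenQuotientMap_reduceSnd.surjective q) with hf
  have key : ∀ p, f (reduceSnd p) = G₀ p := fun p => by
    have h := Function.surjInv_eq isOpenQuotientMap_reduceSnd.surjective (reduceSnd p)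
    simp only [hf]
    generalize Function.surjInv isOpenQuotientMap_reduceSnd.surjective (reduceSnd p) = p' at h
    obtain ⟨y', x'⟩ := p'
    obtain ⟨y, x⟩ := p
    rw [reduceSnd, reduceSnd, Prod.mk.injEq] at h
    obtain ⟨h1, h2⟩ := h
    have hn : ∀ i, ∃ n : ℤ, x i + n = x' i := fun i => by
      have hi : ((x' i - x i : ℝ) : UnitAddCircle) = 0 := by
        rw [AddCircle.coe_sub, sub_eq_zero]
        exact congrFun h2 i
      obtain ⟨n, hn⟩ := AddCircle.coe_eq_zero_iff (1 : ℝ) |>.mp hi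
      exact ⟨n, by rw [zsmul_eq_mul, mul_one] at hn; rw [hn]; ring⟩
    choose n hn using hn
    simp only [hG₀] at h1 ⊢
    rw [h1, ← hinv (transl n) (transl_mem n) (pointXY x _), transl_smul_pointXY]
    congr 2
    exact funext fun i => (hn i).symm
  refine ⟨⟨f, ?_⟩, fun x y => key (y, x)⟩
  rw [isOpenQuotientMap_reduceSnd.isQuotientMap.continuous_iff]
  convert hcont using 1
  exact funext key

/-- A `Γ_∞`-invariant continuous function with imaginary parts confined to a compact set lies in the
uniform closure of the span of the `h_S`: expand in a Fourier series in `X`, and approximate the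
coefficients by factorizable functions of `Y`. -/
theorem mem_approxSpan (r : Lambda2 → Fin 2) {M : ℝ} (hM0 : 0 ≤ M) {G : H2 → ℂ}
    (hG : Continuous G) (hinv : ∀ n ∈ GammaInf, ∀ Z, G (n • Z) = G Z)
    (hM : ∀ Z, G Z ≠ 0 → ‖logIm Z‖ ≤ M) : G ∈ approxSpan r (2 * (M + 3 + 3)) := by
  obtain ⟨f, hf⟩ := exists_torus_lift hG hinv
  have hfZ : ∀ Z, f (logIm Z, torusRe Z) = G Z := fun Z => by
    have := hf (reCoord Z) (logIm Z)
    rwa [logIm, logHomeo.symm_apply_apply, pointXY_reCoord] at this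
  intro ε hε
  obtain ⟨s, w, v, hw, hw0, hws, hw1, hwv⟩ := exists_sum_prod_smul_approx
    (f := fun y => f.curry y) f.curry.continuous hM0 (fun y hy => by
      obtain ⟨τ, hτ⟩ : ∃ τ, f (y, τ) ≠ 0 := by
        by_contra! h
        exact hy (ContinuousMap.ext h)
      obtain ⟨⟨y', x⟩, hx⟩ := isOpenQuotientMap_reduceSnd.surjective (y, τ)
      have hy' : y' = y := congrArg Prod.fst hx
      rw [← hx, hf] at hτ
      have := hM _ hτ
      rwa [logIm, imPos_pointXY, logHomeo.apply_symm_apply, hy'] at this)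
    (show 0 < ε / 3 by positivity)
  have hp : ∀ k, ∃ p ∈ Submodule.span ℂ (Set.range (UnitAddTorus.mFourier (d := Fin 3))),
      ‖v k - p‖ < ε / 3 := fun k => by
    have : v k ∈ (Submodule.span ℂ
        (Set.range (UnitAddTorus.mFourier (d := Fin 3)))).topologicalClosure := by
      rw [UnitAddTorus.span_mFourier_closure_eq_top]
      trivial
    obtain ⟨p, hp, hd⟩ := Metric.mem_closure_iff.mp this (ε / 3) (by positivity)
    exact ⟨p, hp, by rwa [dist_eq_norm] at hd⟩
  choose p hp hvp using hp
  obtain ⟨Ψ, hΨ, hΨe⟩ := (show (∑ k ∈ s, fun Z => p k (torusRe Z) *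
      ((∏ i, w k i (logIm Z i) : ℝ) : ℂ)) ∈ approxSpan r (2 * (M + 3 + 3)) from
    Submodule.sum_mem _ fun k hk => mul_torusRe_mem_approxSpan r
      (g := fun y => ((∏ i, w k i (y i) : ℝ) : ℂ)) (by positivity)
      (Complex.continuous_ofReal.comp (continuous_finsetProd _ fun i _ =>
        (hw k i).continuous.comp (continuous_apply i)))
      (fun y hy => (pi_norm_le_iff_of_nonneg (by positivity)).mpr fun i => hws k hk i _
        (Finset.prod_ne_zero_iff.mp (by exact_mod_cast hy) i (Finset.mem_univ i)))
      (hp k)) (ε / 3) (by positivity)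
  refine ⟨Ψ, hΨ, fun Z => ?_⟩
  have h1 := (ContinuousMap.norm_coe_le_norm _ (torusRe Z)).trans (hwv (logIm Z))
  rw [ContinuousMap.sub_apply, ContinuousMap.curry_apply, hfZ, ContinuousMap.sum_apply] at h1
  have h2 := hΨe Z
  rw [Finset.sum_apply] at h2
  have h3 : ‖∑ k ∈ s, ((∏ i, w k i (logIm Z i)) • v k) (torusRe Z) -
      ∑ k ∈ s, p k (torusRe Z) * ((∏ i, w k i (logIm Z i) : ℝ) : ℂ)‖ ≤ ε / 3 := by
    rw [← Finset.sum_sub_distrib]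
    refine (norm_sum_le _ _).trans ?_
    calc _ ≤ ∑ k ∈ s, (∏ i, w k i (logIm Z i)) * (ε / 3) := by
          refine Finset.sum_le_sum fun k _ => ?_
          have hP : 0 ≤ ∏ i, w k i (logIm Z i) := Finset.prod_nonneg fun i _ => hw0 k i _
          rw [ContinuousMap.smul_apply, Complex.real_smul, mul_comm, ← sub_mul, norm_mul,
            Complex.norm_real, Real.norm_of_nonneg hP, mul_comm]
          refine mul_le_mul_of_nonneg_left ?_ hP
          exact (ContinuousMap.norm_coe_le_norm (v k - p k) (torusRe Z)).trans (hvp k).le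
      _ = (∑ k ∈ s, ∏ i, w k i (logIm Z i)) * (ε / 3) := by rw [Finset.sum_mul]
      _ ≤ 1 * (ε / 3) := mul_le_mul_of_nonneg_right (hw1 _) (by positivity)
      _ = ε / 3 := one_mul _
  calc ‖G Z - Ψ Z‖ ≤ ‖G Z - ∑ k ∈ s, ((∏ i, w k i (logIm Z i)) • v k) (torusRe Z)‖ +
        ‖∑ k ∈ s, ((∏ i, w k i (logIm Z i)) • v k) (torusRe Z) -
          ∑ k ∈ s, p k (torusRe Z) * ((∏ i, w k i (logIm Z i) : ℝ) : ℂ)‖ +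
        ‖∑ k ∈ s, p k (torusRe Z) * ((∏ i, w k i (logIm Z i) : ℝ) : ℂ) - Ψ Z‖ := by
          refine le_trans (le_of_eq ?_) (norm_add₃_le)
          congr 1
          ring
    _ ≤ ε := by linarith

/-! ### Density of the Poincaré series -/

/-- Only finitely many cosets move `Z` into the box of radius `M` of the logarithmic coordinates. -/
theorem finite_box (M : ℝ) (Z : H2) : {q : Cosets | ‖logIm (q.out • Z)‖ ≤ M}.Finite := by
  have hK : IsCompact (logHomeo ⁻¹' Metric.closedBall 0 M) :=
    logHomeo.isCompact_preimage.mpr (isCompact_closedBall 0 M)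
  refine (finite_cosets hK (isCompact_singleton (x := Z))).subset fun q hq => ⟨Z, rfl, ?_⟩
  exact mem_closedBall_zero_iff.mpr hq

/-- The sum over `Γ_∞ \ Γ` of the translates of a `Γ_∞`-invariant function. -/
noncomputable def cosetSum (G : H2 → ℂ) (Z : H2) : ℂ := ∑ᶠ q : Cosets, G (q.out • Z)

theorem cosetSum_eq_sum {G : H2 → ℂ} {M : ℝ} (hG : ∀ Z, G Z ≠ 0 → ‖logIm Z‖ ≤ M) (Z : H2) :
    cosetSum G Z = ∑ q ∈ (finite_box M Z).toFinset, G (q.out • Z) := by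
  refine finsum_eq_sum_of_support_subset _ fun q hq => ?_
  rw [Set.Finite.coe_toFinset]
  exact hG _ hq

theorem cosetSum_hS (h : M2 → ℂ) (S : Lambda2) (Z : H2) :
    cosetSum (hS h S) Z = poincare h S (proj Z) :=
  finsum_congr fun q => (poincareTerm_eq h S Z q).symm

/-- The product of the cut-off functions in the logarithmic coordinates. -/
noncomputable def boxCut (M : ℝ) (y : Fin 3 → ℝ) : ℝ := ∏ i, cut M (y i)

theorem contDiff_boxCut (M : ℝ) : ContDiff ℝ ∞ (boxCut M) :=
  contDiff_prod fun i _ => (contDiff_cut M).comp (contDiff_apply ℝ ℝ i)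

theorem boxCut_nonneg {M : ℝ} (hM : 0 ≤ M) (y : Fin 3 → ℝ) : 0 ≤ boxCut M y :=
  Finset.prod_nonneg fun _ _ => cut_nonneg hM _

theorem boxCut_eq_one {M : ℝ} {y : Fin 3 → ℝ} (hy : ‖y‖ ≤ M) : boxCut M y = 1 :=
  Finset.prod_eq_one fun i _ => cut_eq_one ((norm_le_pi_norm y i).trans hy)

theorem norm_le_of_boxCut_ne_zero {M : ℝ} (hM : 0 ≤ M) {y : Fin 3 → ℝ} (hy : boxCut M y ≠ 0) :
    ‖y‖ ≤ M + 1 :=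
  (pi_norm_le_iff_of_nonneg (by positivity)).mpr fun i =>
    (abs_lt_of_cut_ne_zero hM (Finset.prod_ne_zero_iff.mp hy i (Finset.mem_univ i))).le

/-- A smooth cut-off function on `𝓜₂`. -/
noncomputable def etaM2 (M : ℝ) : M2 → ℂ := (fun y => (boxCut M y : ℂ)) ∘ logM2

theorem isCcSmoothM2_etaM2 {M : ℝ} (hM : 0 ≤ M) : IsCcSmoothM2 (etaM2 M) :=
  isCcSmoothM2_comp_logM2 (Complex.ofRealCLM.contDiff.comp (contDiff_boxCut M))
    (HasCompactSupport.of_norm_le fun y hy =>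
      norm_le_of_boxCut_ne_zero hM (by exact_mod_cast hy))

/-- The Poincaré series with `S = 0` attached to a cut-off function, as a real function. It dominates
the coset sums of functions bounded by `1` and supported where the cut-off function is `1`. -/
noncomputable def majorant (M : ℝ) (q : Quot2) : ℝ := (poincare (etaM2 M) (freq 0) q).re

theorem hS_etaM2 (M : ℝ) (Z : H2) : hS (etaM2 M) (freq 0) Z = (boxCut M (logIm Z) : ℂ) := by
  rw [etaM2, hS_comp_logM2, ← mFourier_torusRe, UnitAddTorus.mFourier_zero]
  simp

theorem majorant_eq {M N : ℝ} (hM : 0 ≤ M) (hN : M + 1 ≤ N) (Z : H2) :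
    majorant M (proj Z) = ∑ q ∈ (finite_box N Z).toFinset, boxCut M (logIm (q.out • Z)) := by
  rw [majorant, ← cosetSum_hS, cosetSum_eq_sum (M := N), Complex.re_sum]
  · simp only [hS_etaM2, Complex.ofReal_re]
  · intro Z hZ
    rw [hS_etaM2] at hZ
    exact (norm_le_of_boxCut_ne_zero hM (by exact_mod_cast hZ)).trans hN

theorem majorant_nonneg {M : ℝ} (hM : 0 ≤ M) (q : Quot2) : 0 ≤ majorant M q := by
  obtain ⟨Z, rfl⟩ := proj_surjective q
  rw [majorant_eq hM le_rfl]
  exact Finset.sum_nonneg fun _ _ => boxCut_nonneg hM _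

theorem logIm_smul_of_mem {n : Sp4Z} (hn : n ∈ GammaInf) (Z : H2) : logIm (n • Z) = logIm Z := by
  rw [logIm, logIm, imPos_smul_of_mem hn]

theorem one_le_majorant {M : ℝ} (hM : 0 ≤ M) {Z : H2} (hZ : ‖logIm Z‖ ≤ M) :
    1 ≤ majorant M (proj Z) := by
  rw [majorant_eq hM le_rfl]
  have h1 : logIm ((Quotient.mk _ 1 : Cosets).out • Z) = logIm Z := by
    rw [logIm, imPos_out_smul, one_smul]
    rfl
  refine ((boxCut_eq_one hZ).symm.trans (congrArg _ h1.symm)).trans_le (Finset.single_le_sum (f := fun q : Cosets => boxCut M (logIm (q.out • Z)))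
    (fun _ _ => boxCut_nonneg hM _) ?_)
  rw [Set.Finite.mem_toFinset]
  change ‖logIm ((Quotient.mk _ 1 : Cosets).out • Z)‖ ≤ M + 1
  rw [h1]
  linarith

theorem continuous_of_comp_proj {X : Type*} [TopologicalSpace X] {φ : Quot2 → X}
    (h : Continuous fun Z => φ (proj Z)) : Continuous φ :=
  (isQuotientMap_quotient_mk' (s := MulAction.orbitRel Sp4Z H2)).continuous_iff.mpr h

theorem IsCcSmoothQuot.continuous {φ : Quot2 → ℂ} (h : IsCcSmoothQuot φ) : Continuous φ :=
  continuous_of_comp_proj h.1.continuous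

theorem continuous_majorant {M : ℝ} (hM : 0 ≤ M) : Continuous (majorant M) :=
  Complex.continuous_re.comp (isCcSmoothQuot_poincare (isCcSmoothM2_etaM2 hM) _).continuous

theorem hasCompactSupport_majorant {M : ℝ} (hM : 0 ≤ M) : HasCompactSupport (majorant M) :=
  (isCcSmoothQuot_poincare (isCcSmoothM2_etaM2 hM) (freq 0)).2.comp_left Complex.zero_re

theorem norm_cosetSum_le {G : H2 → ℂ} {M ε : ℝ} (hM : 0 ≤ M) (hε : 0 ≤ ε)
    (hG : ∀ Z, G Z ≠ 0 → ‖logIm Z‖ ≤ M) (hb : ∀ Z, ‖G Z‖ ≤ ε) (Z : H2) :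
    ‖cosetSum G Z‖ ≤ ε * majorant M (proj Z) := by
  rw [cosetSum_eq_sum (M := M + 1) fun Z hZ => (hG Z hZ).trans (by linarith),
    majorant_eq hM le_rfl, Finset.mul_sum]
  refine (norm_sum_le _ _).trans (Finset.sum_le_sum fun q _ => ?_)
  by_cases h0 : G (q.out • Z) = 0
  · rw [h0, norm_zero]
    exact mul_nonneg hε (boxCut_nonneg hM _)
  · rw [boxCut_eq_one (hG _ h0), mul_one]
    exact hb _

/-- The support of a compactly supported function on `Γ \ ℍ₂` is covered by a box in the logarithmic
coordinates. -/
theorem exists_box_of_hasCompactSupport {φ : Quot2 → ℂ} (hc : HasCompactSupport φ) :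
    ∃ M : ℝ, 0 ≤ M ∧ ∀ q, φ q ≠ 0 → ∃ Z, proj Z = q ∧ ‖logIm Z‖ ≤ M := by
  obtain ⟨n, hn⟩ := hc.isCompact.elim_directed_cover
    (fun n : ℕ => proj '' {Z | ‖logIm Z‖ < n})
    (fun n => isOpenMap_proj _ (isOpen_lt continuous_logIm.norm continuous_const))
    (fun q _ => by
      obtain ⟨Z, rfl⟩ := proj_surjective q
      obtain ⟨n, hn⟩ := exists_nat_gt ‖logIm Z‖
      exact Set.mem_iUnion.mpr ⟨n, Z, hn, rfl⟩)
    (directed_of_isDirected_le fun m n hmn => Set.image_mono fun Z (hZ : ‖logIm Z‖ < m) =>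
      hZ.trans_le (Nat.cast_le.mpr hmn))
  refine ⟨n, n.cast_nonneg, fun q hq => ?_⟩
  obtain ⟨Z, hZ, rfl⟩ := hn (subset_tsupport _ hq)
  exact ⟨Z, rfl, le_of_lt hZ⟩

/-- Every compactly supported continuous function on `Γ \ ℍ₂` is the coset sum of a
`Γ_∞`-invariant function with imaginary parts confined to a compact set. -/
theorem exists_unfolding {φ : Quot2 → ℂ} (hφ : Continuous φ) (hc : HasCompactSupport φ) :
    ∃ (M : ℝ) (G : H2 → ℂ), 0 ≤ M ∧ Continuous G ∧ (∀ n ∈ GammaInf, ∀ Z, G (n • Z) = G Z) ∧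
      (∀ Z, G Z ≠ 0 → ‖logIm Z‖ ≤ M) ∧ ∀ Z, cosetSum G Z = φ (proj Z) := by
  obtain ⟨M, hM, hcov⟩ := exists_box_of_hasCompactSupport hc
  have hmax : ∀ q : Quot2, max (majorant M q) 1 ≠ 0 := fun q =>
    (lt_of_lt_of_le one_pos (le_max_right _ _)).ne'
  -- the maximum with `1` makes `G` continuous; it changes nothing where `φ` does not vanish, since
  -- the majorant is at least `1` there
  set G : H2 → ℂ := fun Z => φ (proj Z) * ((boxCut M (logIm Z) /
    max (majorant M (proj Z)) 1 : ℝ) : ℂ) with hG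
  have hsupp : ∀ Z, G Z ≠ 0 → ‖logIm Z‖ ≤ M + 1 := fun Z hZ => by
    have h1 : boxCut M (logIm Z) / max (majorant M (proj Z)) 1 ≠ 0 := by
      exact_mod_cast right_ne_zero_of_mul hZ
    exact norm_le_of_boxCut_ne_zero hM (div_ne_zero_iff.mp h1).1
  refine ⟨M + 1, G, by positivity, ?_, fun n hn Z => ?_, hsupp, fun Z => ?_⟩
  · refine (hφ.comp continuous_proj).mul (Complex.continuous_ofReal.comp ?_)
    exact ((contDiff_boxCut M).continuous.comp continuous_logIm).div
      (((continuous_majorant hM).comp continuous_proj).max continuous_const) fun Z => hmax _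
  · simp only [hG, proj_smul, logIm_smul_of_mem hn]
  · rw [cosetSum_eq_sum hsupp]
    simp only [hG, proj_smul]
    rw [← Finset.mul_sum, ← Complex.ofReal_sum, ← Finset.sum_div, ← majorant_eq hM le_rfl]
    by_cases h0 : φ (proj Z) = 0
    · rw [h0, zero_mul]
    · obtain ⟨W, hW, hWM⟩ := hcov _ h0
      have h1 : 1 ≤ majorant M (proj Z) := hW ▸ one_le_majorant hM hWM
      rw [max_eq_left h1, div_self (by linarith), Complex.ofReal_one, mul_one]

/-- Uniform density: compactly supported continuous functions on `Γ \ ℍ₂` are uniform limits of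
linear combinations of Poincaré series with data in the families selected by `r`. -/
theorem exists_poincare_approx (r : Lambda2 → Fin 2) {φ : Quot2 → ℂ} (hφ : Continuous φ)
    (hc : HasCompactSupport φ) {ε : ℝ} (hε : 0 < ε) :
    ∃ (n : ℕ) (c : Fin n → ℂ) (h : Fin n → M2 → ℂ) (S : Fin n → Lambda2),
      (∀ i, h i ∈ (![R1, R2] : Fin 2 → Set (M2 → ℂ)) (r (S i))) ∧ (∀ i, IsCcSmoothM2 (h i)) ∧
      ∀ q, ‖φ q - ∑ i, c i * poincare (h i) (S i) q‖ < ε := by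
  obtain ⟨M, G, hM, hG, hinv, hsupp, hsum⟩ := exists_unfolding hφ hc
  set N := 2 * (M + 3 + 3) with hN
  have hN0 : 0 ≤ N := by positivity
  obtain ⟨B, hB⟩ := (continuous_majorant hN0).bounded_above_of_compact_support
    (hasCompactSupport_majorant hN0)
  have hB0 : 0 ≤ B := (norm_nonneg _).trans (hB (proj ⟨_, (diagPoint I I).2⟩))
  obtain ⟨Ψ, hΨ, hΨε⟩ := mem_approxSpan r hM hG hinv hsupp (ε / (B + 1)) (by positivity)
  obtain ⟨n, c, g, rfl⟩ := (Submodule.mem_span_set' (R := ℂ)).mp hΨ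
  choose S h hR hsm hbox hgS using fun i => (g i).2
  have hbox' : ∀ i Z, hS (h i) (S i) Z ≠ 0 → ‖logIm Z‖ ≤ N := fun i Z hZ => by
    have := hbox i _ (right_ne_zero_of_mul hZ)
    rwa [logM2_symm_imPos] at this
  refine ⟨n, c, h, S, hR, hsm, fun q => ?_⟩
  obtain ⟨Z, rfl⟩ := proj_surjective q
  set D : H2 → ℂ := fun Z => G Z - ∑ i, c i * hS (h i) (S i) Z with hD
  have hDeq : ∀ Z, D Z = G Z - (∑ i, c i • (g i : H2 → ℂ)) Z := fun Z => by
    simp only [hD, Finset.sum_apply, Pi.smul_apply, smul_eq_mul, hgS]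
  have hDsupp : ∀ Z, D Z ≠ 0 → ‖logIm Z‖ ≤ N := fun Z hZ => by
    by_contra hn
    apply hZ
    have h1 : G Z = 0 := by
      by_contra h
      exact hn ((hsupp Z h).trans (by rw [hN]; linarith))
    have h2 : ∀ i, hS (h i) (S i) Z = 0 := fun i => by
      by_contra h
      exact hn (hbox' i Z h)
    simp [hD, h1, h2]
  have hcs : cosetSum D Z = φ (proj Z) - ∑ i, c i * poincare (h i) (S i) (proj Z) := by
    rw [cosetSum_eq_sum hDsupp, ← hsum, cosetSum_eq_sum (M := N)
      fun Z hZ => (hsupp Z hZ).trans (by rw [hN]; linarith)]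
    simp only [hD, Finset.sum_sub_distrib]
    rw [Finset.sum_comm]
    simp only [← Finset.mul_sum, ← cosetSum_hS]
    congr 1
    exact Finset.sum_congr rfl fun i _ => by rw [cosetSum_eq_sum (hbox' i)]
  rw [← hcs]
  refine (norm_cosetSum_le (ε := ε / (B + 1)) hN0 (by positivity) hDsupp (fun Z => ?_) Z).trans_lt ?_
  · rw [hDeq]
    exact hΨε Z
  · have h1 := (le_abs_self _).trans (hB (proj Z))
    calc ε / (B + 1) * majorant N (proj Z) ≤ ε / (B + 1) * B :=
          mul_le_mul_of_nonneg_left h1 (by positivity)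
      _ < ε := by
          rw [div_mul_eq_mul_div, div_lt_iff₀ (by positivity)]
          nlinarith

/-! ### The fundamental domain has finite volume -/

/-- The image in `Γ` of the inversion `z ↦ -1/z` of the first factor of `ℍ × ℍ ⊆ ℍ₂`; its factor
`det(CZ + D)` is `z₁₁`. -/
def flip₁ : Sp4Z :=
  ⟨fromBlocks !![0, 0; 0, 1] !![-1, 0; 0, 0] !![1, 0; 0, 0] !![0, 0; 0, 1], by
    rw [SymplecticGroup.fromBlocks_mem_iff]
    decide⟩

theorem det_den_flip₁ (Z : H2) : (den flip₁ Z.mat).det = Z.mat 0 0 := by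
  have h1 : flip₁.1.toBlocks₂₁ = !![1, 0; 0, 0] := rfl
  have h2 : flip₁.1.toBlocks₂₂ = !![0, 0; 0, 1] := rfl
  rw [den, h1, h2, det_fin_two]
  simp [Matrix.mul_apply]

theorem measurableSet_fundDomain : MeasurableSet fundDomain := by
  have hi : ∀ i j, Continuous fun Z : H2 => Z.im i j := fun i j => continuous_im.matrix_elem i j
  have hr : ∀ i j, Continuous fun Z : H2 => Z.re i j := fun i j => continuous_re.matrix_elem i j
  have hd : ∀ γ : Sp4Z, Continuous fun Z : H2 => (den γ Z.mat).det := fun γ => by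
    unfold den
    exact ((continuous_const.matrix_mul continuous_mat).add continuous_const).matrix_det
  refine IsClosed.measurableSet (IsClosed.and ?_ (IsClosed.and ?_ ?_))
  · rw [Set.ofPred_forall]
    exact isClosed_iInter fun γ => isClosed_le continuous_const (hd γ).norm
  · exact IsClosed.and (isClosed_le continuous_const (continuous_const.mul (hi 0 1)))
      (IsClosed.and (isClosed_le (continuous_const.mul (hi 0 1)) (hi 0 0))
        (isClosed_le (hi 0 0) (hi 1 1)))
  · simp only [Set.ofPred_forall]
    exact isClosed_iInter fun i => isClosed_iInter fun j =>
      isClosed_le (hr i j).abs continuous_const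

/-- One factor of the integrable majorant of `(det Y)⁻³` on the fundamental domain. -/
noncomputable def stripWeight (z : ℂ) : ℝ :=
  (Set.Icc (-(1 / 2) : ℝ) (1 / 2)).indicator 1 z.re * (1 + z.im ^ 2)⁻¹

theorem integrable_stripWeight : Integrable stripWeight := by
  have h1 : Integrable ((Set.Icc (-(1 / 2) : ℝ) (1 / 2)).indicator (1 : ℝ → ℝ)) :=
    (integrable_indicator_iff measurableSet_Icc).mpr
      (integrableOn_const (C := (1 : ℝ)) isCompact_Icc.measure_lt_top.ne)
  have h2 : Integrable fun p : ℝ × ℝ =>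
      (Set.Icc (-(1 / 2) : ℝ) (1 / 2)).indicator (1 : ℝ → ℝ) p.1 * (1 + p.2 ^ 2)⁻¹ :=
    h1.mul_prod integrable_inv_one_add_sq
  exact Complex.volume_preserving_equiv_real_prod.integrable_comp_emb
    Complex.measurableEquivRealProd.measurableEmbedding |>.mpr h2

/-- On the fundamental domain `y₁₁² ≥ 3/4` and `det Y ≥ (3/4) y₁₁ y₂₂`, which bounds `(det Y)⁻³` by
an integrable product. -/
theorem inv_det_cube_le {Z : H2} (hZ : Z ∈ fundDomain) :
    (Z.im.det ^ 3)⁻¹ ≤ 27 * ∏ i, stripWeight (Z.coord i) := by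
  obtain ⟨hγ, ⟨hb, hab, hac⟩, hx⟩ := hZ
  have hs : Z.im 1 0 = Z.im 0 1 := by simp [H2.im, Z.mat_one_zero]
  have hx00 := abs_le.mp (hx 0 0)
  have hx01 := abs_le.mp (hx 0 1)
  have hx11 := abs_le.mp (hx 1 1)
  have hz : 1 ≤ ‖Z.mat 0 0‖ := by
    have := hγ flip₁
    rwa [det_den_flip₁] at this
  have hn : 1 ≤ Z.re 0 0 ^ 2 + Z.im 0 0 ^ 2 := by
    have h1 : ‖Z.mat 0 0‖ ^ 2 = Z.re 0 0 ^ 2 + Z.im 0 0 ^ 2 := by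
      rw [← Complex.normSq_eq_norm_sq, Complex.normSq_apply]
      simp [H2.re, H2.im, sq]
    rw [← h1]
    exact one_le_pow₀ hz
  have hprod : ∏ i, stripWeight (Z.coord i) =
      ((1 + Z.im 0 0 ^ 2) * (1 + Z.im 0 1 ^ 2) * (1 + Z.im 1 1 ^ 2))⁻¹ := by
    rw [Fin.prod_univ_three]
    change ((Set.Icc (-(1 / 2) : ℝ) (1 / 2)).indicator 1 (Z.re 0 0) * (1 + Z.im 0 0 ^ 2)⁻¹) *
      ((Set.Icc (-(1 / 2) : ℝ) (1 / 2)).indicator 1 (Z.re 0 1) * (1 + Z.im 0 1 ^ 2)⁻¹) *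
      ((Set.Icc (-(1 / 2) : ℝ) (1 / 2)).indicator 1 (Z.re 1 1) * (1 + Z.im 1 1 ^ 2)⁻¹) = _
    rw [Set.indicator_of_mem (Set.mem_Icc.mpr hx00), Set.indicator_of_mem (Set.mem_Icc.mpr hx01),
      Set.indicator_of_mem (Set.mem_Icc.mpr hx11)]
    simp only [Pi.one_apply, one_mul, mul_inv]
  have hpos : Z.im.PosDef := Z.2.2
  have ha : 0 < Z.im 0 0 := hpos.diag_pos
  have hc : 0 < Z.im 1 1 := hpos.diag_pos
  have hdpos : 0 < Z.im.det := hpos.det_pos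
  have hdet : Z.im.det = Z.im 0 0 * Z.im 1 1 - Z.im 0 1 ^ 2 := by
    rw [det_fin_two, hs]
    ring
  rw [hprod, ← div_eq_mul_inv, inv_eq_one_div, div_le_div_iff₀ (by positivity) (by positivity),
    one_mul]
  generalize Z.im.det = d at *
  generalize Z.im 0 0 = a, Z.im 0 1 = b, Z.im 1 1 = c, Z.re 0 0 = x at *
  have ha2 : 3 / 4 ≤ a ^ 2 := by nlinarith
  have hacm : a ^ 2 ≤ a * c := by nlinarith
  have hb2 : b ^ 2 ≤ a ^ 2 / 4 := by nlinarith
  have hd : 3 / 4 * (a * c) ≤ d := by rw [hdet]; nlinarith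
  have f1 : 1 + a ^ 2 ≤ 7 / 3 * a ^ 2 := by linarith
  have f2 : 1 + b ^ 2 ≤ 2 * (a * c) := by linarith
  have f3 : 1 + c ^ 2 ≤ 7 / 3 * c ^ 2 := by nlinarith
  calc (1 + a ^ 2) * (1 + b ^ 2) * (1 + c ^ 2)
      ≤ (7 / 3 * a ^ 2) * (2 * (a * c)) * (7 / 3 * c ^ 2) := by gcongr
    _ = 98 / 9 * (a * c) ^ 3 := by ring
    _ ≤ 27 * (3 / 4 * (a * c)) ^ 3 := by
        have : 0 ≤ (a * c) ^ 3 := by positivity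
        nlinarith
    _ ≤ 27 * d ^ 3 := by gcongr

theorem lintegral_comap_coord_le (f : (Fin 3 → ℂ) → ENNReal) :
    ∫⁻ Z, f (H2.coord Z) ∂(Measure.comap H2.coord volume) ≤ ∫⁻ c, f c := by
  have hemb : MeasurableEmbedding H2.coord := isOpenEmbedding_coord.measurableEmbedding
  rw [← hemb.lintegral_map, hemb.map_comap]
  exact setLIntegral_le_lintegral _ _

theorem mu_fundDomain_lt_top : mu fundDomain < ⊤ := by
  have hint : Integrable fun c : Fin 3 → ℂ => 27 * ∏ i, stripWeight (c i) :=
    (Integrable.fintype_prod (f := fun _ : Fin 3 => stripWeight)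
      fun _ => integrable_stripWeight).const_mul 27
  rw [mu, withDensity_apply _ measurableSet_fundDomain]
  refine lt_of_le_of_lt ?_ hint.lintegral_lt_top
  refine le_trans ?_ (lintegral_comap_coord_le _)
  refine le_trans ?_ (setLIntegral_le_lintegral fundDomain _)
  exact setLIntegral_mono' measurableSet_fundDomain fun Z hZ =>
    ENNReal.ofReal_le_ofReal (inv_det_cube_le hZ)

instance : IsFiniteMeasure (mu.restrict fundDomain) :=
  ⟨by rw [Measure.restrict_apply_univ]; exact mu_fundDomain_lt_top⟩

/-! ### Weighted averages and their limits -/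

section WeightedAverage

variable {X : Type*} [MeasurableSpace X] {ν : Measure X}

/-- The average of `φ` with respect to `w dν`. If `w` is not integrable, or has integral zero, the
value is `0`. -/
noncomputable def wAvg (ν : Measure X) (w : X → ℝ) (φ : X → ℂ) : ℂ :=
  (∫ x, (w x : ℂ) * φ x ∂ν) / ∫ x, (w x : ℂ) ∂ν

theorem integrable_of_integral_ne_zero {w : X → ℝ} (h : ∫ x, (w x : ℂ) ∂ν ≠ 0) :
    Integrable (fun x => (w x : ℂ)) ν := by
  by_contra hn
  exact h (integral_undef hn)

theorem wAvg_one {w : X → ℝ} (h : ∫ x, (w x : ℂ) ∂ν ≠ 0) : wAvg ν w (fun _ => 1) = 1 := by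
  simp only [wAvg, mul_one]
  exact div_self h

theorem wAvg_of_integral_eq_zero {w : X → ℝ} (h : ∫ x, (w x : ℂ) ∂ν = 0) (φ : X → ℂ) :
    wAvg ν w φ = 0 := by
  rw [wAvg, h, div_zero]

theorem wAvg_mul_left (w : X → ℝ) (c : ℂ) (φ : X → ℂ) :
    wAvg ν w (fun x => c * φ x) = c * wAvg ν w φ := by
  simp only [wAvg, mul_left_comm _ c, integral_const_mul, mul_div_assoc]

theorem wAvg_sub (w : X → ℝ) {φ ψ : X → ℂ} {C D : ℝ}
    (hφ : AEStronglyMeasurable φ ν) (hφC : ∀ x, ‖φ x‖ ≤ C)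
    (hψ : AEStronglyMeasurable ψ ν) (hψD : ∀ x, ‖ψ x‖ ≤ D) :
    wAvg ν w (fun x => φ x - ψ x) = wAvg ν w φ - wAvg ν w ψ := by
  by_cases h : ∫ x, (w x : ℂ) ∂ν = 0
  · simp only [wAvg_of_integral_eq_zero h, sub_zero]
  · have hi := integrable_of_integral_ne_zero h
    simp only [wAvg, mul_sub]
    rw [integral_sub (hi.mul_bdd hφ (ae_of_all _ hφC)) (hi.mul_bdd hψ (ae_of_all _ hψD)), sub_div]

theorem wAvg_sum (w : X → ℝ) {n : ℕ} {φ : Fin n → X → ℂ} {C : Fin n → ℝ}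
    (hφ : ∀ i, AEStronglyMeasurable (φ i) ν) (hφC : ∀ i x, ‖φ i x‖ ≤ C i) :
    wAvg ν w (fun x => ∑ i, φ i x) = ∑ i, wAvg ν w (φ i) := by
  by_cases h : ∫ x, (w x : ℂ) ∂ν = 0
  · simp only [wAvg_of_integral_eq_zero h, Finset.sum_const_zero]
  · have hi := integrable_of_integral_ne_zero h
    simp only [wAvg, Finset.mul_sum]
    rw [integral_finsetSum _ fun i _ => hi.mul_bdd (hφ i) (ae_of_all _ (hφC i)), Finset.sum_div]

theorem norm_wAvg_le_norm_wAvg {w : X → ℝ} (hw : ∀ x, 0 ≤ w x) {φ : X → ℂ} {u : X → ℝ} {C : ℝ}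
    (hu : AEStronglyMeasurable u ν) (huC : ∀ x, |u x| ≤ C) (h : ∀ x, ‖φ x‖ ≤ u x) :
    ‖wAvg ν w φ‖ ≤ ‖wAvg ν w (fun x => (u x : ℂ))‖ := by
  by_cases h0 : ∫ x, (w x : ℂ) ∂ν = 0
  · simp only [wAvg_of_integral_eq_zero h0, le_refl]
  · have hi : Integrable w ν := (integrable_of_integral_ne_zero h0).re
    rw [wAvg, wAvg, norm_div, norm_div]
    refine div_le_div_of_nonneg_right ?_ (norm_nonneg _)
    have h1 : ‖∫ x, (w x : ℂ) * (u x : ℂ) ∂ν‖ = ∫ x, w x * u x ∂ν := by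
      simp only [← Complex.ofReal_mul]
      rw [integral_complex_ofReal, Complex.norm_real, Real.norm_of_nonneg]
      exact integral_nonneg fun x => mul_nonneg (hw x) ((norm_nonneg _).trans (h x))
    rw [h1]
    refine norm_integral_le_of_norm_le (hi.mul_bdd hu (ae_of_all _ huC)) (ae_of_all _ fun x => ?_)
    rw [norm_mul, Complex.norm_real, Real.norm_of_nonneg (hw x)]
    exact mul_le_mul_of_nonneg_left (h x) (hw x)

theorem norm_wAvg_le {w : X → ℝ} (hw : ∀ x, 0 ≤ w x) {φ : X → ℂ} {C : ℝ} (hC : 0 ≤ C)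
    (h : ∀ x, ‖φ x‖ ≤ C) : ‖wAvg ν w φ‖ ≤ C := by
  refine (norm_wAvg_le_norm_wAvg hw (u := fun _ => C) (C := |C|) aestronglyMeasurable_const
    (fun _ => le_rfl) h).trans ?_
  by_cases h0 : ∫ x, (w x : ℂ) ∂ν = 0
  · rw [wAvg_of_integral_eq_zero h0, norm_zero]
    exact hC
  · have := wAvg_mul_left (ν := ν) w (C : ℂ) fun _ => 1
    rw [wAvg_one h0] at this
    simp only [mul_one] at this
    rw [this, Complex.norm_real, Real.norm_of_nonneg hC]

/-- The difference of the averages with respect to `w dν` and to `ν`. -/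
noncomputable def avgDiff (ν : Measure X) (w : X → ℝ) (φ : X → ℂ) : ℂ :=
  wAvg ν w φ - wAvg ν 1 φ

theorem avgDiff_mul_left (w : X → ℝ) (c : ℂ) (φ : X → ℂ) :
    avgDiff ν w (fun x => c * φ x) = c * avgDiff ν w φ := by
  rw [avgDiff, avgDiff, wAvg_mul_left, wAvg_mul_left, mul_sub]

/-- Convergence to zero passes to uniform limits. -/
theorem tendsto_avgDiff_of_approx {w : ℕ → X → ℝ} (hw : ∀ i x, 0 ≤ w i x) {φ : X → ℂ} {B : ℝ}
    (hφ : AEStronglyMeasurable φ ν) (hφB : ∀ x, ‖φ x‖ ≤ B)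
    (h : ∀ ε : ℝ, 0 < ε → ∃ (ψ : X → ℂ) (C : ℝ), AEStronglyMeasurable ψ ν ∧ (∀ x, ‖ψ x‖ ≤ C) ∧
      (∀ x, ‖φ x - ψ x‖ ≤ ε) ∧ Tendsto (fun i => avgDiff ν (w i) ψ) atTop (𝓝 0)) :
    Tendsto (fun i => avgDiff ν (w i) φ) atTop (𝓝 0) := by
  rw [Metric.tendsto_atTop']
  intro ε hε
  obtain ⟨ψ, C, hψ, hψC, hd, ht⟩ := h (ε / 4) (by positivity)
  obtain ⟨N, hN⟩ := Metric.tendsto_atTop'.mp ht (ε / 4) (by positivity)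
  refine ⟨N, fun i hi => ?_⟩
  have h1 := hN i hi
  rw [dist_zero_right] at h1 ⊢
  have e1 := wAvg_sub (w i) hφ hφB hψ hψC
  have e2 := wAvg_sub 1 hφ hφB hψ hψC
  have n1 := norm_wAvg_le (ν := ν) (hw i) (by positivity) hd
  have n2 := norm_wAvg_le (ν := ν) (w := 1) (fun _ => zero_le_one) (by positivity) hd
  have e3 : avgDiff ν (w i) φ = avgDiff ν (w i) ψ + wAvg ν (w i) (fun x => φ x - ψ x) -
      wAvg ν 1 (fun x => φ x - ψ x) := by
    rw [e1, e2, avgDiff, avgDiff]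
    ring
  rw [e3]
  refine (norm_sub_le _ _).trans_lt ?_
  have := norm_add_le (avgDiff ν (w i) ψ) (wAvg ν (w i) (fun x => φ x - ψ x))
  linarith

theorem aestronglyMeasurable_ofReal {u : X → ℝ} (hu : AEStronglyMeasurable u ν) :
    AEStronglyMeasurable (fun x => (u x : ℂ)) ν :=
  Complex.continuous_ofReal.comp_aestronglyMeasurable hu

/-- Vague convergence of averages to a finite measure implies convergence on bounded functions:
testing on the cut-off functions `χₙ` shows that no mass of the averages escapes, and in particular
that for large `i` the weight `wᵢ` is integrable with non-zero integral. -/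
theorem tendsto_avgDiff_of_cutoff [IsFiniteMeasure ν] {w : ℕ → X → ℝ} (hw : ∀ i x, 0 ≤ w i x)
    {χ : ℕ → X → ℝ} (hχ : ∀ n, AEStronglyMeasurable (χ n) ν) (hχ0 : ∀ n x, 0 ≤ χ n x)
    (hχ1 : ∀ n x, χ n x ≤ 1) (hχt : ∀ x, Tendsto (fun n => χ n x) atTop (𝓝 1))
    {φ : X → ℂ} {B : ℝ} (hφ : AEStronglyMeasurable φ ν) (hB : ∀ x, ‖φ x‖ ≤ B)
    (h1 : ∀ n, Tendsto (fun i => avgDiff ν (w i) fun x => (χ n x : ℂ)) atTop (𝓝 0))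
    (h2 : ∀ n, Tendsto (fun i => avgDiff ν (w i) fun x => (χ n x : ℂ) * φ x) atTop (𝓝 0)) :
    Tendsto (fun i => avgDiff ν (w i) φ) atTop (𝓝 0) := by
  rcases eq_or_ne ν 0 with rfl | hν
  · simp [avgDiff, wAvg]
  have hone : ∫ x, (((1 : X → ℝ) x : ℝ) : ℂ) ∂ν ≠ 0 := by
    simp [Measure.real, ENNReal.toReal_eq_zero_iff, hν, measure_ne_top]
  have hlim : Tendsto (fun n => wAvg ν 1 fun x => (χ n x : ℂ)) atTop (𝓝 1) := by
    rw [← wAvg_one hone]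
    refine Tendsto.div_const (tendsto_integral_of_dominated_convergence (fun _ => 1)
      (fun n => ?_) (integrable_const 1) (fun n => ae_of_all _ fun x => ?_)
      (ae_of_all _ fun x => ?_)) _
    · simpa using aestronglyMeasurable_ofReal (hχ n)
    · rw [Pi.one_apply, Complex.ofReal_one, one_mul, Complex.norm_real,
        Real.norm_of_nonneg (hχ0 n x)]
      exact hχ1 n x
    · have := (Complex.continuous_ofReal.tendsto 1).comp (hχt x)
      rw [Complex.ofReal_one] at this
      exact this.const_mul _
  have hX : Nonempty X := by
    by_contra hX
    rw [not_nonempty_iff] at hX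
    exact hν (Measure.eq_zero_of_isEmpty ν)
  have hB0 : 0 ≤ B := (norm_nonneg _).trans (hB hX.some)
  rw [Metric.tendsto_atTop']
  intro ε hε
  set δ := min (1 / 4) (ε / (2 * (1 + 3 * B))) with hδ
  have hδ0 : 0 < δ := by positivity
  have hδ1 : δ ≤ 1 / 4 := min_le_left _ _
  have hδε : δ * (1 + 3 * B) < ε := by
    have : δ ≤ ε / (2 * (1 + 3 * B)) := min_le_right _ _
    rw [le_div_iff₀ (by positivity)] at this
    linarith
  obtain ⟨n, hn⟩ := ((Metric.tendsto_nhds.mp hlim) δ hδ0).exists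
  obtain ⟨N₁, hN₁⟩ := Metric.tendsto_atTop'.mp (h1 n) δ hδ0
  obtain ⟨N₂, hN₂⟩ := Metric.tendsto_atTop'.mp (h2 n) δ hδ0
  refine ⟨max N₁ N₂, fun i hi => ?_⟩
  have d1 := hN₁ i (lt_of_le_of_lt (le_max_left _ _) hi)
  have d2 := hN₂ i (lt_of_le_of_lt (le_max_right _ _) hi)
  rw [dist_zero_right] at d1 d2 ⊢
  rw [dist_eq_norm, norm_sub_rev] at hn
  have hclose : ‖1 - wAvg ν (w i) fun x => (χ n x : ℂ)‖ < 2 * δ := by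
    have : (1 - wAvg ν (w i) fun x => (χ n x : ℂ)) =
        (1 - wAvg ν 1 fun x => (χ n x : ℂ)) - avgDiff ν (w i) fun x => (χ n x : ℂ) := by
      rw [avgDiff]
      ring
    rw [this]
    exact (norm_sub_le _ _).trans_lt (by linarith)
  -- a weight without a non-zero integral has all averages zero, so its average of `χₙ` would be far
  -- from `1`
  have hwi : ∫ x, (w i x : ℂ) ∂ν ≠ 0 := by
    intro h0
    rw [wAvg_of_integral_eq_zero h0, sub_zero, norm_one] at hclose
    linarith
  have hχn : ∀ x, ‖(χ n x : ℂ)‖ ≤ 1 := fun x => by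
    rw [Complex.norm_real, Real.norm_of_nonneg (hχ0 n x)]
    exact hχ1 n x
  have hχm := aestronglyMeasurable_ofReal (hχ n)
  -- `φ - χₙ φ` is dominated by `B (1 - χₙ)`
  have tail : ∀ v : X → ℝ, (∀ x, 0 ≤ v x) → ∫ x, (v x : ℂ) ∂ν ≠ 0 →
      ‖wAvg ν v φ - wAvg ν v (fun x => (χ n x : ℂ) * φ x)‖ ≤
        B * ‖1 - wAvg ν v fun x => (χ n x : ℂ)‖ := fun v hv hv0 => by
    have hb : ∀ x, ‖(χ n x : ℂ) * φ x‖ ≤ 1 * B := fun x => by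
      rw [norm_mul]
      exact mul_le_mul (hχn x) (hB x) (norm_nonneg _) zero_le_one
    have hm : AEStronglyMeasurable (fun x => (χ n x : ℂ) * φ x) ν := hχm.mul hφ
    rw [← wAvg_sub v hφ hB hm hb]
    refine (norm_wAvg_le_norm_wAvg hv (u := fun x => B * (1 - χ n x)) (C := B)
      ((aestronglyMeasurable_const.sub (hχ n)).const_mul B) (fun x => ?_) fun x => ?_).trans ?_
    · rw [abs_of_nonneg (mul_nonneg hB0 (sub_nonneg.mpr (hχ1 n x)))]
      nlinarith [hχ0 n x]
    · have e1 : φ x - (χ n x : ℂ) * φ x = ((1 - χ n x : ℝ) : ℂ) * φ x := by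
        push_cast
        ring
      rw [e1, norm_mul, Complex.norm_real, Real.norm_of_nonneg (sub_nonneg.mpr (hχ1 n x)), mul_comm]
      exact mul_le_mul_of_nonneg_right (hB x) (sub_nonneg.mpr (hχ1 n x))
    · have e2 := wAvg_sub (ν := ν) v (φ := fun _ => (1 : ℂ)) aestronglyMeasurable_const
        (fun _ => le_of_eq norm_one) hχm hχn
      rw [wAvg_one hv0] at e2
      rw [← e2]
      push_cast
      rw [wAvg_mul_left, norm_mul, Complex.norm_real, Real.norm_of_nonneg hB0]
  have t1 := tail (w i) (hw i) hwi
  have t2 := tail 1 (fun _ => zero_le_one) hone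
  have key : avgDiff ν (w i) φ = avgDiff ν (w i) (fun x => (χ n x : ℂ) * φ x) +
      (wAvg ν (w i) φ - wAvg ν (w i) (fun x => (χ n x : ℂ) * φ x)) -
      (wAvg ν 1 φ - wAvg ν 1 (fun x => (χ n x : ℂ) * φ x)) := by
    rw [avgDiff, avgDiff]
    ring
  rw [key]
  have n1 := norm_sub_le (avgDiff ν (w i) (fun x => (χ n x : ℂ) * φ x) +
      (wAvg ν (w i) φ - wAvg ν (w i) (fun x => (χ n x : ℂ) * φ x)))
      (wAvg ν 1 φ - wAvg ν 1 (fun x => (χ n x : ℂ) * φ x))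
  have n2 := norm_add_le (avgDiff ν (w i) (fun x => (χ n x : ℂ) * φ x))
      (wAvg ν (w i) φ - wAvg ν (w i) (fun x => (χ n x : ℂ) * φ x))
  nlinarith

end WeightedAverage

/-! ### Equidistribution of mass -/

/-- The density `|F|² (det Y)^k`. -/
noncomputable def massDensity (k : ℤ) (F : H2 → ℂ) (Z : H2) : ℝ := ‖F Z‖ ^ 2 * Z.im.det ^ k

theorem massDensity_nonneg (k : ℤ) (F : H2 → ℂ) (Z : H2) : 0 ≤ massDensity k F Z := by
  have : 0 < Z.im.det := (show Z.im.PosDef from Z.2.2).det_pos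
  unfold massDensity
  positivity

theorem DF_eq_avgDiff (k : ℤ) (F : H2 → ℂ) (φ : Quot2 → ℂ) :
    DF k F φ = avgDiff (mu.restrict fundDomain) (massDensity k F) fun Z => φ (proj Z) := by
  simp only [DF, muF, avgDiff, wAvg, massDensity, mul_one, Pi.one_apply, Complex.ofReal_one,
    one_mul]
  congr 2
  simp [Measure.real]

/-- If `D_F → 0` on the Poincaré series with data in the selected families, then `D_F → 0` on all
bounded continuous functions. -/
theorem tendsto_DF (r : Lambda2 → Fin 2) (k : ℕ → ℤ) (F : ℕ → H2 → ℂ)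
    (h : ∀ (S : Lambda2) (h : M2 → ℂ), h ∈ (![R1, R2] : Fin 2 → Set (M2 → ℂ)) (r S) →
      IsCcSmoothM2 h → Tendsto (fun i => DF (k i) (F i) (poincare h S)) atTop (𝓝 0))
    (φ : Quot2 →ᵇ ℂ) : Tendsto (fun i => DF (k i) (F i) φ) atTop (𝓝 0) := by
  simp only [DF_eq_avgDiff] at h ⊢
  have meas : ∀ {ψ : Quot2 → ℂ}, Continuous ψ →
      AEStronglyMeasurable (fun Z => ψ (proj Z)) (mu.restrict fundDomain) := fun hψ =>
    (hψ.comp continuous_proj).aestronglyMeasurable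
  have hcc : ∀ ψ : Quot2 → ℂ, Continuous ψ → HasCompactSupport ψ →
      Tendsto (fun i => avgDiff (mu.restrict fundDomain) (massDensity (k i) (F i))
        fun Z => ψ (proj Z)) atTop (𝓝 0) := fun ψ hψ hψc => by
    obtain ⟨B, hB⟩ := hψ.bounded_above_of_compact_support hψc
    refine tendsto_avgDiff_of_approx (fun i => massDensity_nonneg _ _) (meas hψ)
      (fun Z => hB _) fun ε hε => ?_
    obtain ⟨n, c, g, S, hR, hsm, hap⟩ := exists_poincare_approx r hψ hψc hε
    have hcont : ∀ i, Continuous (poincare (g i) (S i)) := fun i =>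
      (isCcSmoothQuot_poincare (hsm i) (S i)).continuous
    choose C hC using fun i => (hcont i).bounded_above_of_compact_support
      (isCcSmoothQuot_poincare (hsm i) (S i)).2
    have hC' : ∀ i (Z : H2), ‖c i * poincare (g i) (S i) (proj Z)‖ ≤ ‖c i‖ * C i := fun i Z => by
      rw [norm_mul]
      exact mul_le_mul_of_nonneg_left (hC i _) (norm_nonneg _)
    refine ⟨fun Z => ∑ i, c i * poincare (g i) (S i) (proj Z), ∑ i, ‖c i‖ * C i, ?_,
      fun Z => (norm_sum_le _ _).trans (Finset.sum_le_sum fun i _ => hC' i Z),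
      fun Z => (hap _).le, ?_⟩
    · exact meas (ψ := fun q => ∑ i, c i * poincare (g i) (S i) q)
        (continuous_finsetSum _ fun i _ => continuous_const.mul (hcont i))
    · have hm : ∀ i, AEStronglyMeasurable (fun Z => c i * poincare (g i) (S i) (proj Z))
          (mu.restrict fundDomain) := fun i => (meas (hcont i)).const_mul _
      have e : ∀ j, avgDiff (mu.restrict fundDomain) (massDensity (k j) (F j))
          (fun Z => ∑ i, c i * poincare (g i) (S i) (proj Z)) =
          ∑ i, c i * avgDiff (mu.restrict fundDomain) (massDensity (k j) (F j))
            fun Z => poincare (g i) (S i) (proj Z) := fun j => by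
        rw [avgDiff, wAvg_sum _ hm hC', wAvg_sum _ hm hC', ← Finset.sum_sub_distrib]
        exact Finset.sum_congr rfl fun i _ => avgDiff_mul_left _ _ _
      simp only [e]
      have := tendsto_finsetSum Finset.univ fun i _ => (h (S i) (g i) (hR i) (hsm i)).const_mul (c i)
      simpa using this
  have hχc : ∀ n : ℕ, Continuous fun q : Quot2 => min (majorant n q) 1 := fun n =>
    (continuous_majorant n.cast_nonneg).min continuous_const
  have hχs : ∀ n : ℕ, HasCompactSupport fun q : Quot2 => ((min (majorant n q) 1 : ℝ) : ℂ) :=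
    fun n => (hasCompactSupport_majorant n.cast_nonneg).comp_left
      (g := fun t : ℝ => ((min t 1 : ℝ) : ℂ)) (by simp)
  refine tendsto_avgDiff_of_cutoff (fun i => massDensity_nonneg _ _)
    (χ := fun n Z => min (majorant n (proj Z)) 1)
    (fun n => ((hχc n).comp continuous_proj).aestronglyMeasurable)
    (fun n Z => le_min (majorant_nonneg n.cast_nonneg _) zero_le_one)
    (fun n Z => min_le_right _ _) (fun Z => ?_) (meas φ.continuous)
    (fun Z => φ.norm_coe_le_norm _) (fun n => ?_) fun n => ?_
  · refine tendsto_const_nhds.congr' ?_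
    filter_upwards [eventually_ge_atTop ⌈‖logIm Z‖⌉₊] with n hn
    rw [min_eq_right (one_le_majorant n.cast_nonneg (Nat.ceil_le.mp hn))]
  · exact hcc (fun q => ((min (majorant n q) 1 : ℝ) : ℂ))
      (Complex.continuous_ofReal.comp (hχc n)) (hχs n)
  · exact hcc (fun q => ((min (majorant n q) 1 : ℝ) : ℂ) * φ q)
      ((Complex.continuous_ofReal.comp (hχc n)).mul φ.continuous) (hχs n).mul_right

theorem IsCcSmoothM2.const_mul {h : M2 → ℂ} (hh : IsCcSmoothM2 h) (c : ℂ) :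
    IsCcSmoothM2 fun m => c * h m :=
  ⟨SmoothIn.mul ⟨fun _ => c, contDiffOn_const, fun _ => rfl⟩ hh.1, hh.2.mul_left⟩

theorem poincare_const_mul {h : M2 → ℂ} (hh : IsCcSmoothM2 h) (c : ℂ) (S : Lambda2) (q : Quot2) :
    poincare (fun m => c * h m) S q = c * poincare h S q := by
  obtain ⟨Z, rfl⟩ := proj_surjective q
  change poincareH2 _ S Z = c * poincareH2 h S Z
  rw [poincareH2, poincareH2, mul_finsum' _ _ (support_poincareTerm_finite hh.2 S Z)]
  refine finsum_congr fun q => ?_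
  rw [poincareTerm_eq, poincareTerm_eq, hS, hS]
  ring

end SiegelPoincare

open SiegelPoincare in
theorem mainTheorem10 :
    -- each Poincaré series is a finite sum and lies in `C_c^∞(Γ \ ℍ₂)`
    (∀ (h : M2 → ℂ) (S : Lambda2), IsCcSmoothM2 h →
      (∀ Z : H2, (Function.support (poincareTerm h S Z)).Finite) ∧
      IsCcSmoothQuot (poincare h S)) ∧
    -- the finite linear combinations are uniformly dense in `C_c^∞(Γ \ ℍ₂)`
    (∀ φ : Quot2 → ℂ, IsCcSmoothQuot φ → ∀ ε : ℝ, 0 < ε →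
      ∃ (r : ℕ) (a : Fin r → ℝ) (h : Fin r → M2 → ℂ) (S : Fin r → Lambda2),
        (∀ i, IsCcSmoothM2 (h i)) ∧
        ∀ Z : Quot2, ‖φ Z - ∑ i, (a i : ℂ) * poincare (h i) (S i) Z‖ < ε) ∧
    -- reduction of mass equidistribution to Poincaré series
    (∀ (k : ℕ → ℤ) (F : ℕ → H2 → ℂ), (∀ i, IsCuspForm (k i) (F i)) → (∀ i, F i ≠ 0) →
      (∀ (S : Lambda2) (h : M2 → ℂ), IsCcSmoothM2 h →
        Tendsto (fun i => DF (k i) (F i) (poincare h S)) atTop (𝓝 0)) →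
      ∀ φ : Quot2 →ᵇ ℂ, Tendsto (fun i => DF (k i) (F i) φ) atTop (𝓝 0)) ∧
    -- reduction of mass equidistribution to Poincaré series with factorizable data
    (∀ (k : ℕ → ℤ) (F : ℕ → H2 → ℂ), (∀ i, IsCuspForm (k i) (F i)) → (∀ i, F i ≠ 0) →
      ∀ r : Lambda2 → Fin 2,
      (∀ (S : Lambda2) (h : M2 → ℂ), h ∈ ![R1, R2] (r S) →
        Tendsto (fun i => DF (k i) (F i) (poincare h S)) atTop (𝓝 0)) →
      ∀ φ : Quot2 →ᵇ ℂ, Tendsto (fun i => DF (k i) (F i) φ) atTop (𝓝 0)) := by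
  refine ⟨fun h S hh => ⟨support_poincareTerm_finite hh.2 S, isCcSmoothQuot_poincare hh S⟩,
    fun φ hφ ε hε => ?_, fun k F _ _ h => tendsto_DF (fun _ => 1) k F fun S g _ hg => h S g hg,
    fun k F _ _ r h => tendsto_DF r k F fun S g hg _ => h S g hg⟩
  obtain ⟨n, c, h, S, -, hh, hap⟩ := exists_poincare_approx (fun _ => 1) hφ.continuous hφ.2 hε
  refine ⟨n, fun _ => 1, fun i m => c i * h i m, S, fun i => (hh i).const_mul (c i), fun q => ?_⟩
  simp only [Complex.ofReal_one, one_mul, poincare_const_mul (hh _)]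
  exact hap q
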